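/- **Setting.** Let $\mathcal X=\{1,\dots,k\}$, let $h:\mathcal X\to\mathbb R^d$, let $\Theta\subseteq\mathbb R^p$ and $\alpha:\Theta\to\mathbb R^d$, and for $\theta\in\Theta$ let $$E_\theta=\Bigl\{P:\ P(x)>0\ \ \forall x,\ \ \sum_xP(x)=1,\ \ \sum_x P(x)h(x)=\alpha(\theta)\Bigr\},$$ assumed nonempty for every $\theta\in\Theta$. Let $Q$ be a probability vector on $\mathcal X$ with $Q(x)>0$ for all $x$, write $D(P\|R)=\sum_xP(x)\log\frac{P(x)}{R(x)}$, and let $P^*_\theta=\arg\min_{P\in E_\theta}D(P\|Q)$ be the information projection of $Q$ onto $E_\theta$. Let $P_0$ be any probability vector on $\mathcal X$ (the truth, which need not lie in any $E_\theta$; the case $P_0=Q$, in which the data are drawn from the truth and $P^*_\theta=\arg\min_{P\in E_\theta}D(P\|P_0)$, is included), and let $\theta_0\in\Theta$ be pseudo-true: it minimizes $\theta\mapsto D(P_0\|P^*_\theta)$ over $\Theta$. Let $\mathsf T^*=\{v\in\mathbb R^k:\sum_xv_x=0,\ \sum_xv_xh(x)=0\}$. Assume that $\mathsf T^*\neq\{0\}$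 and that $\mathsf T^*$ is spanned by its integer vectors (as is the case if $h$ is rational valued). Let $H^*_{\theta_0}=\Pi_{\mathsf T^*}\,\mathrm{diag}(1/P^*_{\theta_0})\,\Pi_{\mathsf T^*}$, regarded as an operator on $\mathsf T^*$, where $\Pi_{\mathsf T^*}$ is the Euclidean orthogonal projection onto $\mathsf T^*$, and let $\lambda_{\min}(H^*_{\theta_0})$ be its smallest eigenvalue. Let $X_1,\dots,X_n$ be i.i.d. with law $Q$, let $P_n$ be their empirical measure, and let $E_{\theta_0,n}$ be the set of those members of $E_{\theta_0}$ that are empirical measures of samples of size $n$. For $m\le n$ and $E_{\theta_0,n}\ne\emptyset$ the predictive law on $\mathcal X^m$ is $$\mu_{n,m}(x_{1:m})=\sum_{P\in E_{\theta_0,n}}\Pr(X_{1:m}=x_{1:m}\mid P_n=P)\,\Pr(P_n=P\mid P_n\in E_{\theta_0,n}).$$ **Corollary (predictive misspecification).** There is a constant $C>0$ depending only on $k=|\mathcal X|$ such that, in the setting above, for every sequence $m=m_n$ of non-negative integers with $m_n=o\bigl(\sqrt{n\,\lambda_{\min}(H^*_{\theta_0})/\log n}\bigr)$, $$\bigl\|\mu_{n,m_n}-(P^*_{\theta_0})^{\otimes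 m_n}\bigr\|_{\mathrm{TV}}\ \le\ C\,m_n\sqrt{\frac{\log n}{n\,\lambda_{\min}(H^*_{\theta_0})}}$$ for all sufficiently large $n$ with $E_{\theta_0,n}\neq\emptyset$ (how large may depend on all the data and on the sequence); in particular $\|\mu_{n,m_n}-(P^*_{\theta_0})^{\otimes m_n}\|_{\mathrm{TV}}\to0$ along these $n$. Here the little-$o$ condition, too, is only required along the $n$ with $E_{\theta_0,n}\ne\emptyset$, and $\|\mu-\nu\|_{\mathrm{TV}}=\frac12\sum_y|\mu(y)-\nu(y)|$. -/

import Mathlib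

open Filter Asymptotics

/-! Finite sample space `Fin k`; laws on it are vectors `Fin k → ℝ`. -/

namespace ConstrainedPrediction

noncomputable section

/-- `P` is a probability vector. -/
def IsProb {k : ℕ} (P : Fin k → ℝ) : Prop :=
  (∀ x, 0 ≤ P x) ∧ ∑ x, P x = 1

/-- Kullback--Leibler divergence `D(P ‖ Q)` of two laws on a finite set (with `0 log 0 = 0`);
it is only used with a strictly positive second argument. -/
def kl {k : ℕ} (P Q : Fin k → ℝ) : ℝ :=
  ∑ x, P x * Real.log (P x / Q x)

/-- The constraint set `{P in the open simplex : E_P[h] = a}`. -/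
def constraintSet {k d : ℕ} (h : Fin k → Fin d → ℝ) (a : Fin d → ℝ) : Set (Fin k → ℝ) :=
  {P | (∀ x, 0 < P x) ∧ ∑ x, P x = 1 ∧ ∑ x, P x • h x = a}

/-- `P` minimizes `D(· ‖ Q)` over `E`. -/
def IsInfoProj {k : ℕ} (Q : Fin k → ℝ) (E : Set (Fin k → ℝ)) (P : Fin k → ℝ) : Prop :=
  P ∈ E ∧ ∀ P' ∈ E, kl P Q ≤ kl P' Q

/-- The information projection `argmin_{P ∈ E} D(P ‖ Q)`. -/
def infoProj {k : ℕ} (Q : Fin k → ℝ) (E : Set (Fin k → ℝ)) : Fin k → ℝ :=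
  Classical.epsilon (IsInfoProj Q E)

/-- The tangent space `{v : 1ᵀ v = 0, A v = 0}`, where `A` has the columns `h x`. -/
def tangent {k d : ℕ} (h : Fin k → Fin d → ℝ) : Submodule ℝ (EuclideanSpace ℝ (Fin k)) where
  carrier := {v | ∑ x, v x = 0 ∧ ∑ x, v x • h x = 0}
  zero_mem' := by simp
  add_mem' := by
    rintro v w ⟨hv, hv'⟩ ⟨hw, hw'⟩
    constructor
    · simp [Finset.sum_add_distrib, hv, hw]
    · simp [add_smul, Finset.sum_add_distrib, hv', hw']
  smul_mem' := by
    rintro c v ⟨hv, hv'⟩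
    constructor
    · simp [← Finset.mul_sum, hv]
    · simp [mul_smul, ← Finset.smul_sum, hv']

/-- The projected Hessian `Π_T diag(1/P) Π_T`, as an operator on the tangent space `T`; in an
orthonormal basis `V` of `T` its matrix is `Vᵀ diag(1/P) V`. -/
def projHessian {k : ℕ} (T : Submodule ℝ (EuclideanSpace ℝ (Fin k))) (P : Fin k → ℝ) :
    T →ₗ[ℝ] T :=
  (T.orthogonalProjectionOnto : EuclideanSpace ℝ (Fin k) →ₗ[ℝ] T) ∘ₗ
    Matrix.toEuclideanLin (Matrix.diagonal fun x => 1 / P x) ∘ₗ T.subtype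

/-- The smallest eigenvalue of an operator with real spectrum on a nonzero finite-dimensional
real space. -/
def lambdaMin {V : Type*} [AddCommGroup V] [Module ℝ V] (H : V →ₗ[ℝ] V) : ℝ :=
  sInf {c : ℝ | Module.End.HasEigenvalue H c}

/-- The tangent space is spanned by its integer vectors (so that the types satisfying the
constraints form a lattice of full rank); this holds whenever `h` is rational valued. -/
def IsLatticeConstraint {k d : ℕ} (h : Fin k → Fin d → ℝ) : Prop :=
  Submodule.span ℝ {v | v ∈ tangent h ∧ ∀ x, ∃ z : ℤ, v x = z} = tangent h

/-- The empirical measure of a sample of size `n`. -/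
def empirical {k n : ℕ} (s : Fin n → Fin k) : Fin k → ℝ :=
  fun x => ((Finset.univ.filter fun i => s i = x).card : ℝ) / n

open Classical in
/-- `Pr((X_1, …, X_n) ∈ S)` for `X_1, …, X_n` i.i.d. with law `Q`. -/
def prob {k n : ℕ} (Q : Fin k → ℝ) (S : Set (Fin n → Fin k)) : ℝ :=
  ∑ s with s ∈ S, ∏ i, Q (s i)

/-- `Pr((X_1, …, X_n) ∈ S | (X_1, …, X_n) ∈ S')` for `X_1, …, X_n` i.i.d. with law `Q`. -/
def condProb {k n : ℕ} (Q : Fin k → ℝ) (S S' : Set (Fin n → Fin k)) : ℝ :=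
  prob Q (S ∩ S') / prob Q S'

open Classical in
/-- The feasible empirical types `E_n`: the members of `E` that are empirical measures of a
sample of size `n`. -/
def feasibleTypes {k : ℕ} (E : Set (Fin k → ℝ)) (n : ℕ) : Finset (Fin k → ℝ) :=
  ((Finset.univ : Finset (Fin n → Fin k)).image empirical).filter (· ∈ E)

/-- The event `X_{1:m} = y` for a sample of size `n ≥ m`. -/
def prefixEvent {k m : ℕ} (n : ℕ) (y : Fin m → Fin k) : Set (Fin n → Fin k) :=
  {s | ∀ (i : Fin n) (j : Fin m), (i : ℕ) = j → s i = y j}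

/-- The predictive law
`μ_{n,m}(y) = ∑_{P ∈ E_n} Pr(X_{1:m} = y | P_n = P) Pr(P_n = P | P_n ∈ E_n)`,
for `m ≤ n` and `E_n` nonempty. -/
def predictive {k : ℕ} (Q : Fin k → ℝ) (E : Set (Fin k → ℝ)) (n m : ℕ)
    (y : Fin m → Fin k) : ℝ :=
  ∑ P ∈ feasibleTypes E n,
    condProb Q (prefixEvent n y) {s | empirical s = P} *
      condProb Q {s : Fin n → Fin k | empirical s = P} {s | empirical s ∈ E}

/-- The product law `P^{⊗ m}`. -/
def productLaw {k : ℕ} (P : Fin k → ℝ) (m : ℕ) (y : Fin m → Fin k) : ℝ :=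
  ∏ j, P (y j)

/-- Total variation distance of two laws on a finite set. -/
def tvDist {ι : Type*} [Fintype ι] (μ ν : ι → ℝ) : ℝ :=
  (1 / 2) * ∑ y, |μ y - ν y|

/-- The filter `n → ∞` along the sample sizes for which the conditioning event is possible. -/
def feasibleAtTop {k : ℕ} (E : Set (Fin k → ℝ)) : Filter ℕ :=
  atTop ⊓ 𝓟 {n | (feasibleTypes E n).Nonempty}

end

end ConstrainedPrediction

open ConstrainedPrediction

/-!
On the event `P_n ∈ E` the law `Q` of the sample may be replaced by its information projection `P*`:
the first-order condition at `P*` says that `log (P* / Q)` has the same mean under every member of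
`E`, so there the densities `Q^{⊗ n}` and `P*^{⊗ n}` are proportional. Conditioning `P*^{⊗ n}` on
that event gives an exchangeable law, whose prefixes of length `m` are within `m² / n` of the
mixture of the laws `P_n^{⊗ m}`, and `P_n^{⊗ m}` is within `m ‖P_n - P*‖_TV` of `P*^{⊗ m}`.

It remains to see that `P_n` concentrates around `P*` at the scale `√(log n / (n λ))`. By the
method of types a type `P` has probability `exp (-n D(P ‖ P*))` up to a factor polynomial in `n`.
Rounding in the lattice of integer tangent vectors produces a feasible type at distance `O(1 / n)`
from `P*`, so the conditioning event is only polynomially unlikely; and near `P*` the divergence is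
at least a multiple of `λ ‖P - P*‖²`, so the types beyond that scale are negligible.
-/

namespace ConstrainedPrediction

open InformationTheory (klFun klFun_apply klFun_nonneg)

variable {k d : ℕ}

/-! ### Relative entropy -/

section RelativeEntropy

theorem klFun_le_sq_sub_one {t : ℝ} (ht : 0 ≤ t) : klFun t ≤ (t - 1) ^ 2 := by
  rcases ht.eq_or_lt with rfl | ht
  · simp [klFun_apply]
  · have := mul_le_mul_of_nonneg_left (Real.log_le_sub_one_of_pos ht) ht.le
    rw [klFun_apply]
    linarith

theorem sq_sub_one_le_mul_klFun {t : ℝ} (ht : 0 ≤ t) :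
    (t - 1) ^ 2 ≤ 2 * (t + 1) * klFun t := by
  obtain ⟨a, ha, rfl⟩ : ∃ a : ℝ, 0 ≤ a ∧ t = a ^ 2 :=
    ⟨√t, Real.sqrt_nonneg t, (Real.sq_sqrt ht).symm⟩
  have hsq : (a - 1) ^ 2 ≤ klFun (a ^ 2) := by
    have hfactor : klFun (a ^ 2) = (a - 1) ^ 2 + 2 * a * klFun a := by
      simp only [klFun_apply, Real.log_pow, Nat.cast_ofNat]
      ring
    have := klFun_nonneg ha
    rw [hfactor]
    exact le_add_of_nonneg_right (by positivity)
  calc (a ^ 2 - 1) ^ 2 = (a + 1) ^ 2 * (a - 1) ^ 2 := by ring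
    _ ≤ 2 * (a ^ 2 + 1) * (a - 1) ^ 2 := by
        gcongr
        linarith [sq_nonneg (a - 1)]
    _ ≤ 2 * (a ^ 2 + 1) * klFun (a ^ 2) := by gcongr

theorem mul_klFun_div {p r : ℝ} (hr : r ≠ 0) :
    r * klFun (p / r) = p * Real.log (p / r) + (r - p) := by
  rw [klFun_apply]
  field_simp
  ring

theorem sq_sub_le_mul_klFun_div {p r : ℝ} (hp : 0 ≤ p) (hr : 0 < r) :
    (p - r) ^ 2 ≤ 2 * (p + r) * (r * klFun (p / r)) := by
  have := sq_sub_one_le_mul_klFun (div_nonneg hp hr.le)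
  calc (p - r) ^ 2 = r ^ 2 * (p / r - 1) ^ 2 := by field_simp
    _ ≤ r ^ 2 * (2 * (p / r + 1) * klFun (p / r)) := by gcongr
    _ = 2 * (p + r) * (r * klFun (p / r)) := by field_simp

variable {P Q R : Fin k → ℝ}

theorem kl_eq_sum_mul_klFun (hR : ∀ x, R x ≠ 0) (hsum : ∑ x, P x = ∑ x, R x) :
    kl P R = ∑ x, R x * klFun (P x / R x) := by
  simp only [mul_klFun_div (hR _), Finset.sum_add_distrib, Finset.sum_sub_distrib, hsum, sub_self,
    add_zero, kl]

theorem kl_nonneg (hP : ∀ x, 0 ≤ P x) (hR : ∀ x, 0 < R x) (hsum : ∑ x, P x = ∑ x, R x) :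
    0 ≤ kl P R := by
  rw [kl_eq_sum_mul_klFun (fun x => (hR x).ne') hsum]
  exact Finset.sum_nonneg fun x _ =>
    mul_nonneg (hR x).le (klFun_nonneg (div_nonneg (hP x) (hR x).le))

theorem mul_log_div_le_kl_add (hP : ∀ x, 0 ≤ P x) (hR : ∀ x, 0 < R x)
    (hsum : ∑ x, P x = ∑ x, R x) (x : Fin k) :
    P x * Real.log (P x / R x) ≤ kl P R + (P x - R x) := by
  have hterm := mul_klFun_div (p := P x) (hR x).ne'
  have hle : R x * klFun (P x / R x) ≤ kl P R := by
    rw [kl_eq_sum_mul_klFun (fun y => (hR y).ne') hsum]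
    exact Finset.single_le_sum (f := fun y => R y * klFun (P y / R y))
      (fun y _ => mul_nonneg (hR y).le (klFun_nonneg (div_nonneg (hP y) (hR y).le)))
      (Finset.mem_univ x)
  linarith

theorem kl_le_sum_sq_div (hP : ∀ x, 0 ≤ P x) (hR : ∀ x, 0 < R x)
    (hsum : ∑ x, P x = ∑ x, R x) : kl P R ≤ ∑ x, (P x - R x) ^ 2 / R x := by
  rw [kl_eq_sum_mul_klFun (fun x => (hR x).ne') hsum]
  refine Finset.sum_le_sum fun x _ => ?_
  calc R x * klFun (P x / R x) ≤ R x * (P x / R x - 1) ^ 2 := by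
        gcongr
        · exact (hR x).le
        · exact klFun_le_sq_sub_one (div_nonneg (hP x) (hR x).le)
    _ = (P x - R x) ^ 2 / R x := by
        have := (hR x).ne'
        field_simp

theorem sum_sq_div_le_mul_kl {c : ℝ} (hP : ∀ x, 0 ≤ P x) (hR : ∀ x, 0 < R x)
    (hsum : ∑ x, P x = ∑ x, R x) (hc : ∀ x, P x ≤ c * R x) :
    ∑ x, (P x - R x) ^ 2 / R x ≤ 2 * (c + 1) * kl P R := by
  rw [kl_eq_sum_mul_klFun (fun x => (hR x).ne') hsum, Finset.mul_sum]
  refine Finset.sum_le_sum fun x _ => (div_le_iff₀ (hR x)).2 ?_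
  have hfun : 0 ≤ klFun (P x / R x) := klFun_nonneg (div_nonneg (hP x) (hR x).le)
  have hRx := hR x
  calc (P x - R x) ^ 2 ≤ 2 * (P x + R x) * (R x * klFun (P x / R x)) :=
        sq_sub_le_mul_klFun_div (hP x) hRx
    _ ≤ 2 * (c * R x + R x) * (R x * klFun (P x / R x)) := by
        gcongr
        exact hc x
    _ = 2 * (c + 1) * (R x * klFun (P x / R x)) * R x := by ring

theorem sum_sq_le_four_mul_kl (hP : P ∈ stdSimplex ℝ (Fin k)) (hR : R ∈ stdSimplex ℝ (Fin k))
    (hpos : ∀ x, 0 < R x) : ∑ x, (P x - R x) ^ 2 ≤ 4 * kl P R := by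
  rw [kl_eq_sum_mul_klFun (fun x => (hpos x).ne') (hP.2.trans hR.2.symm), Finset.mul_sum]
  refine Finset.sum_le_sum fun x _ => ?_
  have hfun : 0 ≤ klFun (P x / R x) := klFun_nonneg (div_nonneg (hP.1 x) (hR.1 x))
  have hRx := hpos x
  have hle : P x + R x ≤ 2 := by
    linarith [(mem_Icc_of_mem_stdSimplex hP x).2, (mem_Icc_of_mem_stdSimplex hR x).2]
  calc (P x - R x) ^ 2 ≤ 2 * (P x + R x) * (R x * klFun (P x / R x)) :=
        sq_sub_le_mul_klFun_div (hP.1 x) hRx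
    _ ≤ 2 * 2 * (R x * klFun (P x / R x)) := by gcongr
    _ = 4 * (R x * klFun (P x / R x)) := by ring

theorem kl_eq_kl_add_sum (hR : ∀ x, R x ≠ 0) (hQ : ∀ x, Q x ≠ 0) :
    kl P Q = kl P R + ∑ x, P x * Real.log (R x / Q x) := by
  rw [kl, kl, ← Finset.sum_add_distrib]
  refine Finset.sum_congr rfl fun x _ => ?_
  rcases eq_or_ne (P x) 0 with hPx | hPx
  · simp [hPx]
  · rw [Real.log_div hPx (hQ x), Real.log_div hPx (hR x), Real.log_div (hR x) (hQ x)]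
    ring

theorem kl_mixture (hQ : ∀ x, Q x ≠ 0) {t : ℝ} (hmix : ∀ x, (1 - t) * P x + t * R x ≠ 0) :
    kl (fun x => (1 - t) * P x + t * R x) Q
        + ((1 - t) * kl P (fun x => (1 - t) * P x + t * R x)
          + t * kl R (fun x => (1 - t) * P x + t * R x))
      = (1 - t) * kl P Q + t * kl R Q := by
  rw [kl_eq_kl_add_sum (P := P) hmix hQ, kl_eq_kl_add_sum (P := R) hmix hQ]
  have hlin : kl (fun x => (1 - t) * P x + t * R x) Q
      = (1 - t) * ∑ x, P x * Real.log (((1 - t) * P x + t * R x) / Q x)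
        + t * ∑ x, R x * Real.log (((1 - t) * P x + t * R x) / Q x) := by
    simp only [kl, Finset.mul_sum, ← Finset.sum_add_distrib]
    exact Finset.sum_congr rfl fun x _ => by ring
  rw [hlin]
  ring

theorem continuous_kl_left (hQ : ∀ x, Q x ≠ 0) : Continuous fun P => kl P Q := by
  refine continuous_finsetSum _ fun x _ => ?_
  have hterm (P : Fin k → ℝ) :
      P x * Real.log (P x / Q x) = P x * Real.log (P x) - P x * Real.log (Q x) := by
    rcases eq_or_ne (P x) 0 with hPx | hPx
    · simp [hPx]
    · rw [Real.log_div hPx (hQ x), mul_sub]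
  simp only [hterm]
  exact (Real.continuous_mul_log.comp (continuous_apply x)).sub (by fun_prop)

theorem min_le_kl {p lam : ℝ} (hP : P ∈ stdSimplex ℝ (Fin k)) (hR : R ∈ stdSimplex ℝ (Fin k))
    (hp : 0 < p) (hpR : ∀ x, p ≤ R x)
    (hlam : lam * ∑ x, (P x - R x) ^ 2 ≤ ∑ x, (P x - R x) ^ 2 / R x) :
    min (p ^ 2 / 4) (lam / 6 * ∑ x, (P x - R x) ^ 2) ≤ kl P R := by
  have hpos (x : Fin k) : 0 < R x := hp.trans_le (hpR x)
  by_cases hfar : ∃ x, p ≤ |P x - R x|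
  · obtain ⟨x, hx⟩ := hfar
    refine (min_le_left _ _).trans ?_
    have hcoord : (P x - R x) ^ 2 ≤ ∑ x, (P x - R x) ^ 2 :=
      Finset.single_le_sum (f := fun x => (P x - R x) ^ 2) (fun _ _ => sq_nonneg _)
        (Finset.mem_univ x)
    have hsq : p ^ 2 ≤ (P x - R x) ^ 2 := by
      rw [← sq_abs (P x - R x)]
      gcongr
    linarith [sum_sq_le_four_mul_kl hP hR hpos]
  · push Not at hfar
    refine (min_le_right _ _).trans ?_
    have hdouble (x : Fin k) : P x ≤ 2 * R x := by
      linarith [(abs_lt.1 (hfar x)).2, hpR x]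
    linarith [sum_sq_div_le_mul_kl hP.1 hpos (hP.2.trans hR.2.symm) hdouble]

end RelativeEntropy

/-! ### The information projection -/

section InformationProjection

variable {h : Fin k → Fin d → ℝ} {a : Fin d → ℝ} {P Q R : Fin k → ℝ}

/-- The laws on the closed simplex that meet the moment constraint. Unlike `constraintSet h a` this
polytope is compact, so divergences attain their minimum on it. -/
def closedConstraintSet (h : Fin k → Fin d → ℝ) (a : Fin d → ℝ) : Set (Fin k → ℝ) :=
  stdSimplex ℝ (Fin k) ∩ {P | ∑ x, P x • h x = a}

theorem constraintSet_subset_closedConstraintSet (h : Fin k → Fin d → ℝ) (a : Fin d → ℝ) :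
    constraintSet h a ⊆ closedConstraintSet h a :=
  fun _ hP => ⟨⟨fun x => (hP.1 x).le, hP.2.1⟩, hP.2.2⟩

theorem isCompact_closedConstraintSet (h : Fin k → Fin d → ℝ) (a : Fin d → ℝ) :
    IsCompact (closedConstraintSet h a) :=
  (isCompact_stdSimplex ℝ (Fin k)).inter_right (isClosed_eq (by fun_prop) continuous_const)

theorem mixture_mem_constraintSet (hP : P ∈ closedConstraintSet h a) (hR : R ∈ constraintSet h a)
    {t : ℝ} (ht : 0 < t) (ht' : t ≤ 1) :
    (fun x => (1 - t) * P x + t * R x) ∈ constraintSet h a := by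
  obtain ⟨⟨hP₀, hP₁⟩, hPa : ∑ x, P x • h x = a⟩ := hP
  obtain ⟨hR₀, hR₁, hRa⟩ := hR
  refine ⟨fun x => ?_, ?_, ?_⟩
  · exact add_pos_of_nonneg_of_pos (mul_nonneg (sub_nonneg.2 ht') (hP₀ x)) (mul_pos ht (hR₀ x))
  · simp [Finset.sum_add_distrib, ← Finset.mul_sum, hP₁, hR₁]
  · simp only [add_smul, mul_smul, Finset.sum_add_distrib, ← Finset.smul_sum]
    rw [hPa, hRa, ← add_smul, sub_add_cancel, one_smul]

theorem kl_mixture_le_sub_of_isMinOn (hQ : ∀ x, 0 < Q x)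
    (hP : P ∈ closedConstraintSet h a)
    (hmin : IsMinOn (fun P => kl P Q) (closedConstraintSet h a) P) (hR : R ∈ constraintSet h a)
    {t : ℝ} (ht : 0 < t) (ht' : t ≤ 1) :
    kl R (fun x => (1 - t) * P x + t * R x) ≤ kl R Q - kl P Q := by
  have hmem := mixture_mem_constraintSet hP hR ht ht'
  have hle : kl P Q ≤ kl (fun x => (1 - t) * P x + t * R x) Q :=
    hmin (constraintSet_subset_closedConstraintSet h a hmem)
  have hnonneg : 0 ≤ (1 - t) * kl P (fun x => (1 - t) * P x + t * R x) :=
    mul_nonneg (sub_nonneg.2 ht') (kl_nonneg hP.1.1 hmem.1 (hP.1.2.trans hmem.2.1.symm))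
  have hmix := kl_mixture (P := P) (R := R) (fun x => (hQ x).ne') fun x => (hmem.1 x).ne'
  refine le_of_mul_le_mul_left ?_ ht
  linarith

/-- If `P x = 0`, the mixtures of `P` with `R` have mass `t * R x` at `x`, so the divergence of `R`
from them blows up as `t → 0`, against the bound at a minimizer. -/
theorem pos_of_isMinOn_kl (hQ : ∀ x, 0 < Q x) (hP : P ∈ closedConstraintSet h a)
    (hmin : IsMinOn (fun P => kl P Q) (closedConstraintSet h a) P)
    (hne : (constraintSet h a).Nonempty) (x : Fin k) : 0 < P x := by
  obtain ⟨R, hR⟩ := hne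
  refine (hP.1.1 x).lt_of_ne' fun hPx => ?_
  have hbound (t : ℝ) (ht : t ∈ Set.Ioc 0 1) :
      -(R x * Real.log t) ≤ kl R Q - kl P Q + R x := by
    have hmem := mixture_mem_constraintSet hP hR ht.1 ht.2
    have hkl := kl_mixture_le_sub_of_isMinOn hQ hP hmin hR ht.1 ht.2
    have hcoord := mul_log_div_le_kl_add (fun y => (hR.1 y).le) hmem.1
      (hR.2.1.trans hmem.2.1.symm) x
    have hratio : Real.log (R x / ((1 - t) * P x + t * R x)) = -Real.log t := by
      rw [hPx, mul_zero, zero_add, div_mul_cancel_right₀ (hR.1 x).ne', Real.log_inv]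
    rw [hratio] at hcoord
    linarith [hmem.1 x]
  have hlim : Tendsto (fun t => R x * Real.log t) (nhdsWithin 0 (Set.Ioi 0)) atBot :=
    Real.tendsto_log_nhdsGT_zero.const_mul_atBot (hR.1 x)
  obtain ⟨t, hlt, ht⟩ :=
    ((hlim.eventually_lt_atBot (-(kl R Q - kl P Q + R x))).and
      (Ioc_mem_nhdsGT (zero_lt_one (α := ℝ)))).exists
  linarith [hbound t ht]

theorem isInfoProj_infoProj (hQ : ∀ x, 0 < Q x) (hne : (constraintSet h a).Nonempty) :
    IsInfoProj Q (constraintSet h a) (infoProj Q (constraintSet h a)) := by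
  obtain ⟨P, hP, hmin⟩ := (isCompact_closedConstraintSet h a).exists_isMinOn
    (hne.mono (constraintSet_subset_closedConstraintSet h a))
    (continuous_kl_left fun x => (hQ x).ne').continuousOn
  exact Classical.epsilon_spec (p := IsInfoProj Q (constraintSet h a))
    ⟨P, ⟨pos_of_isMinOn_kl hQ hP hmin hne, hP.1.2, hP.2⟩,
      fun R hR => hmin (constraintSet_subset_closedConstraintSet h a hR)⟩

theorem add_smul_mem_constraintSet (hP : P ∈ constraintSet h a) {v : EuclideanSpace ℝ (Fin k)}
    (hv : v ∈ tangent h) {t : ℝ} (hpos : ∀ x, 0 < P x + t * v x) :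
    (fun x => P x + t * v x) ∈ constraintSet h a := by
  refine ⟨hpos, ?_, ?_⟩
  · simp [Finset.sum_add_distrib, ← Finset.mul_sum, hP.2.1, hv.1]
  · simp [add_smul, mul_smul, Finset.sum_add_distrib, ← Finset.smul_sum, hP.2.2, hv.2]

theorem toLp_sub_mem_tangent (hP : P ∈ constraintSet h a) (hR : R ∈ constraintSet h a) :
    WithLp.toLp 2 (P - R) ∈ tangent h := by
  constructor
  · simp [Finset.sum_sub_distrib, hP.2.1, hR.2.1]
  · simp [sub_smul, Finset.sum_sub_distrib, hP.2.2, hR.2.2]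

theorem hasDerivAt_kl_add_smul (hP : ∀ x, P x ≠ 0) (hQ : ∀ x, Q x ≠ 0) (v : Fin k → ℝ) :
    HasDerivAt (fun t : ℝ => kl (fun x => P x + t * v x) Q)
      (∑ x, v x * (Real.log (P x / Q x) + 1)) 0 := by
  refine HasDerivAt.fun_sum fun x _ => ?_
  have hlin : HasDerivAt (fun t : ℝ => P x + t * v x) (v x) 0 := by
    simpa using ((hasDerivAt_id (0 : ℝ)).mul_const (v x)).const_add (P x)
  have hne : (P x + 0 * v x) / Q x ≠ 0 := by simpa using ⟨hP x, hQ x⟩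
  have hderiv : v x * (Real.log (P x / Q x) + 1) = v x * Real.log ((P x + 0 * v x) / Q x)
      + (P x + 0 * v x) * (v x / Q x / ((P x + 0 * v x) / Q x)) := by
    have := hP x
    have := hQ x
    simp only [zero_mul, add_zero]
    field_simp
  rw [hderiv]
  exact hlin.mul ((hlin.div_const (Q x)).log hne)

theorem IsInfoProj.sum_mul_log_eq_zero (hQ : ∀ x, 0 < Q x) (hP : IsInfoProj Q (constraintSet h a) P)
    {v : EuclideanSpace ℝ (Fin k)} (hv : v ∈ tangent h) :
    ∑ x, v x * Real.log (P x / Q x) = 0 := by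
  have hpos : ∀ᶠ t : ℝ in nhds 0, ∀ x, 0 < P x + t * v x := by
    refine eventually_all.2 fun x => ?_
    have hlim : Tendsto (fun t : ℝ => P x + t * v x) (nhds 0) (nhds (P x + 0 * v x)) :=
      Continuous.tendsto (by fun_prop) 0
    exact hlim.eventually_const_lt (by simpa using hP.1.1 x)
  have hmin : IsLocalMin (fun t : ℝ => kl (fun x => P x + t * v x) Q) 0 := by
    filter_upwards [hpos] with t ht
    simpa using hP.2 _ (add_smul_mem_constraintSet hP.1 hv ht)
  have hderiv := hmin.hasDerivAt_eq_zero
    (hasDerivAt_kl_add_smul (fun x => (hP.1.1 x).ne') (fun x => (hQ x).ne') v)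
  simpa [mul_add, Finset.sum_add_distrib, hv.1] using hderiv

theorem IsInfoProj.sum_mul_log_eq_kl (hQ : ∀ x, 0 < Q x)
    (hR : IsInfoProj Q (constraintSet h a) R) (hP : P ∈ constraintSet h a) :
    ∑ x, P x * Real.log (R x / Q x) = kl R Q := by
  have := hR.sum_mul_log_eq_zero hQ (toLp_sub_mem_tangent hP hR.1)
  simpa [sub_mul, sub_eq_zero, kl] using this

end InformationProjection

/-! ### Total variation distance -/

section TotalVariation

variable {ι κ : Type*} [Fintype ι] [Fintype κ]

theorem tvDist_nonneg (μ ν : ι → ℝ) : 0 ≤ tvDist μ ν :=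
  mul_nonneg (by norm_num) (Finset.sum_nonneg fun _ _ => abs_nonneg _)

theorem tvDist_triangle (μ ν ρ : ι → ℝ) : tvDist μ ρ ≤ tvDist μ ν + tvDist ν ρ := by
  rw [tvDist, tvDist, tvDist, ← mul_add, ← Finset.sum_add_distrib]
  gcongr
  exact abs_sub_le _ _ _

theorem tvDist_le_one {μ ν : ι → ℝ} (hμ : μ ∈ stdSimplex ℝ ι) (hν : ν ∈ stdSimplex ℝ ι) :
    tvDist μ ν ≤ 1 := by
  have hle : ∑ y, |μ y - ν y| ≤ ∑ y, (μ y + ν y) := by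
    refine Finset.sum_le_sum fun y _ => abs_le.2 ⟨?_, ?_⟩ <;> linarith [hμ.1 y, hν.1 y]
  rw [Finset.sum_add_distrib, hμ.2, hν.2] at hle
  rw [tvDist]
  linarith

theorem tvDist_le_sqrt (μ ν : ι → ℝ) :
    tvDist μ ν ≤ 1 / 2 * √(Fintype.card ι * ∑ y, (μ y - ν y) ^ 2) := by
  rw [tvDist]
  gcongr
  refine Real.le_sqrt_of_sq_le ?_
  simpa using sq_sum_le_card_mul_sum_sq (s := Finset.univ) (f := fun y => |μ y - ν y|)

theorem tvDist_sum_mul_le {w : κ → ℝ} (hw : ∀ i, 0 ≤ w i) (μ ν : κ → ι → ℝ) :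
    tvDist (fun y => ∑ i, w i * μ i y) (fun y => ∑ i, w i * ν i y)
      ≤ ∑ i, w i * tvDist (μ i) (ν i) := by
  calc tvDist (fun y => ∑ i, w i * μ i y) (fun y => ∑ i, w i * ν i y)
      ≤ 1 / 2 * ∑ y, ∑ i, w i * |μ i y - ν i y| := by
        rw [tvDist]
        gcongr with y
        rw [← Finset.sum_sub_distrib]
        refine (Finset.abs_sum_le_sum_abs _ _).trans (Finset.sum_le_sum fun i _ => ?_)
        rw [← mul_sub, abs_mul, abs_of_nonneg (hw i)]
    _ = ∑ i, w i * tvDist (μ i) (ν i) := by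
        rw [Finset.sum_comm, Finset.mul_sum]
        refine Finset.sum_congr rfl fun i _ => ?_
        rw [tvDist, ← Finset.mul_sum]
        ring

theorem tvDist_sum_mul_kernel_le {μ : κ → ι → ℝ} (hμ : ∀ i, μ i ∈ stdSimplex ℝ ι) (v w : κ → ℝ) :
    tvDist (fun y => ∑ i, v i * μ i y) (fun y => ∑ i, w i * μ i y) ≤ tvDist v w := by
  rw [tvDist, tvDist]
  gcongr 1 / 2 * ?_
  calc ∑ y, |∑ i, v i * μ i y - ∑ i, w i * μ i y| ≤ ∑ y, ∑ i, |v i - w i| * μ i y := by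
        gcongr with y
        rw [← Finset.sum_sub_distrib]
        refine (Finset.abs_sum_le_sum_abs _ _).trans (Finset.sum_le_sum fun i _ => ?_)
        rw [← sub_mul, abs_mul, abs_of_nonneg ((hμ i).1 y)]
    _ = ∑ i, |v i - w i| := by
        rw [Finset.sum_comm]
        simp only [← Finset.mul_sum, (hμ _).2, mul_one]

theorem tvDist_mul_le {μ μ' : ι → ℝ} {ν ν' : κ → ℝ} (hμ : μ ∈ stdSimplex ℝ ι)
    (hν' : ν' ∈ stdSimplex ℝ κ) :
    tvDist (fun z : ι × κ => μ z.1 * ν z.2) (fun z => μ' z.1 * ν' z.2)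
      ≤ tvDist μ μ' + tvDist ν ν' := by
  have hterm (i : ι) (j : κ) :
      |μ i * ν j - μ' i * ν' j| ≤ μ i * |ν j - ν' j| + |μ i - μ' i| * ν' j := by
    calc |μ i * ν j - μ' i * ν' j| = |μ i * (ν j - ν' j) + (μ i - μ' i) * ν' j| := by ring_nf
      _ ≤ |μ i * (ν j - ν' j)| + |(μ i - μ' i) * ν' j| := abs_add_le _ _
      _ = μ i * |ν j - ν' j| + |μ i - μ' i| * ν' j := by
          rw [abs_mul, abs_mul, abs_of_nonneg (hμ.1 i), abs_of_nonneg (hν'.1 j)]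
  calc tvDist (fun z : ι × κ => μ z.1 * ν z.2) (fun z => μ' z.1 * ν' z.2)
      ≤ 1 / 2 * ∑ i, ∑ j, (μ i * |ν j - ν' j| + |μ i - μ' i| * ν' j) := by
        rw [tvDist, Fintype.sum_prod_type]
        gcongr with i _ j
        exact hterm i j
    _ = tvDist μ μ' + tvDist ν ν' := by
        simp only [Finset.sum_add_distrib, ← Finset.mul_sum, ← Finset.sum_mul, hμ.2, hν'.2,
          tvDist]
        ring

/-- The law of the image under `g` of a random element with law `w`. -/
noncomputable def mapLaw [DecidableEq κ] (w : ι → ℝ) (g : ι → κ) (y : κ) : ℝ :=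
  ∑ i with g i = y, w i

theorem mapLaw_mem_stdSimplex [DecidableEq κ] {w : ι → ℝ} (hw : w ∈ stdSimplex ℝ ι) (g : ι → κ) :
    mapLaw w g ∈ stdSimplex ℝ κ :=
  ⟨fun _ => Finset.sum_nonneg fun i _ => hw.1 i, (Finset.sum_fiberwise _ g w).trans hw.2⟩

/-- The uniform distribution on `J`. -/
noncomputable def uniformLaw [DecidableEq ι] (J : Finset ι) (i : ι) : ℝ :=
  if i ∈ J then (J.card : ℝ)⁻¹ else 0

theorem tvDist_uniformLaw_univ [DecidableEq ι] {J : Finset ι} (hJ : J.Nonempty) :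
    tvDist (uniformLaw J) (uniformLaw Finset.univ) = 1 - J.card / Fintype.card ι := by
  have hJpos : (0 : ℝ) < J.card := Nat.cast_pos.2 hJ.card_pos
  have hle : (J.card : ℝ) ≤ Fintype.card ι := Nat.cast_le.2 J.card_le_univ
  have hin : ∑ i ∈ J, |uniformLaw J i - uniformLaw Finset.univ i|
      = 1 - J.card / Fintype.card ι := by
    have hterm (i : ι) (hi : i ∈ J) : |uniformLaw J i - uniformLaw Finset.univ i|
        = (J.card : ℝ)⁻¹ - (Fintype.card ι : ℝ)⁻¹ := by
      simpa [uniformLaw, hi] using inv_anti₀ hJpos hle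
    rw [Finset.sum_congr rfl hterm, Finset.sum_const, nsmul_eq_mul, mul_sub,
      mul_inv_cancel₀ hJpos.ne', div_eq_mul_inv]
  have hout : ∑ i ∈ Jᶜ, |uniformLaw J i - uniformLaw Finset.univ i|
      = 1 - J.card / Fintype.card ι := by
    have hterm (i : ι) (hi : i ∈ Jᶜ) : |uniformLaw J i - uniformLaw Finset.univ i|
        = (Fintype.card ι : ℝ)⁻¹ := by
      simp [uniformLaw, Finset.mem_compl.1 hi]
    rw [Finset.sum_congr rfl hterm, Finset.sum_const, nsmul_eq_mul, Finset.card_compl,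
      Nat.cast_sub J.card_le_univ, sub_mul, mul_inv_cancel₀ (hJpos.trans_le hle).ne',
      div_eq_mul_inv]
  rw [tvDist, ← Finset.sum_add_sum_compl J, hin, hout]
  ring

end TotalVariation

/-! ### Product laws -/

section ProductLaw

variable {P R : Fin k → ℝ}

theorem productLaw_nonneg (hP : ∀ x, 0 ≤ P x) (m : ℕ) (y : Fin m → Fin k) :
    0 ≤ productLaw P m y :=
  Finset.prod_nonneg fun _ _ => hP _

theorem productLaw_pos (hP : ∀ x, 0 < P x) (m : ℕ) (y : Fin m → Fin k) :
    0 < productLaw P m y :=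
  Finset.prod_pos fun _ _ => hP _

theorem sum_productLaw (P : Fin k → ℝ) (m : ℕ) :
    ∑ y, productLaw P m y = (∑ x, P x) ^ m :=
  (Fintype.sum_pow P m).symm

theorem productLaw_mem_stdSimplex (hP : P ∈ stdSimplex ℝ (Fin k)) (m : ℕ) :
    productLaw P m ∈ stdSimplex ℝ (Fin m → Fin k) :=
  ⟨productLaw_nonneg hP.1 m, by rw [sum_productLaw, hP.2, one_pow]⟩

theorem tvDist_productLaw_le (hP : P ∈ stdSimplex ℝ (Fin k)) (hR : R ∈ stdSimplex ℝ (Fin k))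
    (m : ℕ) : tvDist (productLaw P m) (productLaw R m) ≤ m * tvDist P R := by
  induction m with
  | zero => simp [tvDist, productLaw]
  | succ m ih =>
    have hcons : tvDist (productLaw P (m + 1)) (productLaw R (m + 1))
        = tvDist (fun z : Fin k × (Fin m → Fin k) => P z.1 * productLaw P m z.2)
            (fun z => R z.1 * productLaw R m z.2) := by
      rw [tvDist, tvDist]
      congr 1
      refine (Fintype.sum_equiv (Fin.consEquiv fun _ => Fin k) _ _ fun z => ?_).symm
      simp [productLaw, Fin.prod_univ_succ, Fin.consEquiv]
    have hprod := tvDist_mul_le hP (productLaw_mem_stdSimplex hR m) (μ' := R) (ν := productLaw P m)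
    rw [hcons]
    push_cast
    linarith

end ProductLaw

/-! ### Finite exchangeable sequences -/

section Exchangeable

variable {n m : ℕ}

theorem empirical_eq_sum (s : Fin n → Fin k) (x : Fin k) :
    empirical s x = (∑ i, if s i = x then 1 else 0) / n := by
  rw [empirical, Finset.sum_boole]

theorem empirical_nonneg (s : Fin n → Fin k) (x : Fin k) : 0 ≤ empirical s x := by
  unfold empirical
  positivity

theorem empirical_mem_stdSimplex (hn : 0 < n) (s : Fin n → Fin k) :
    empirical s ∈ stdSimplex ℝ (Fin k) := by
  refine ⟨empirical_nonneg s, ?_⟩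
  have : (n : ℝ) ≠ 0 := by positivity
  simp only [empirical_eq_sum, ← Finset.sum_div]
  rw [Finset.sum_comm]
  simp [this]

/-- `w` is the law of an exchangeable random sequence. -/
def IsExchangeable (w : (Fin n → Fin k) → ℝ) : Prop :=
  ∀ (σ : Equiv.Perm (Fin n)) (s : Fin n → Fin k), w (s ∘ σ) = w s

theorem IsExchangeable.mapLaw_comp_eq {w : (Fin n → Fin k) → ℝ} (hw : IsExchangeable w)
    {f g : Fin m → Fin n} (hf : Function.Injective f) (hg : Function.Injective g) :
    mapLaw w (· ∘ f) = mapLaw w (· ∘ g) := by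
  obtain ⟨σ, hσ⟩ := Equiv.Perm.exists_extending_pair f g hf hg
  funext y
  refine (Finset.sum_equiv (σ.symm.arrowCongr (Equiv.refl (Fin k))) (fun s => ?_)
    fun s _ => (hw σ s).symm).symm
  have hcomp : (s ∘ σ) ∘ f = s ∘ g := by
    funext j
    simp [hσ]
  simp [Equiv.arrowCongr, ← hcomp, Function.comp_assoc]

theorem productLaw_empirical (s : Fin n → Fin k) (y : Fin m → Fin k) :
    productLaw (empirical s) m y
      = ∑ f : Fin m → Fin n, uniformLaw Finset.univ f * if s ∘ f = y then 1 else 0 := by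
  simp only [productLaw, empirical_eq_sum, Finset.prod_div_distrib, Finset.prod_const,
    Finset.card_univ, Fintype.card_fin, Fintype.prod_sum, Finset.prod_ite_zero, uniformLaw]
  simp [funext_iff, div_eq_mul_inv, Finset.sum_ite]

theorem sum_mul_productLaw_empirical (w : (Fin n → Fin k) → ℝ) (y : Fin m → Fin k) :
    ∑ s, w s * productLaw (empirical s) m y
      = ∑ f : Fin m → Fin n, uniformLaw Finset.univ f * mapLaw w (· ∘ f) y := by
  simp only [productLaw_empirical, mapLaw, Finset.sum_filter, Finset.mul_sum]
  rw [Finset.sum_comm]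
  refine Finset.sum_congr rfl fun f _ => Finset.sum_congr rfl fun s _ => ?_
  split_ifs <;> ring

theorem card_injective (n m : ℕ) :
    ((Finset.univ : Finset (Fin m → Fin n)).filter Function.Injective).card
      = n.descFactorial m := by
  rw [← Fintype.card_subtype, Fintype.card_congr (Equiv.subtypeInjectiveEquivEmbedding _ _),
    Fintype.card_embedding_eq, Fintype.card_fin, Fintype.card_fin]

theorem one_sub_sq_div_le_descFactorial_div (hmn : m ≤ n) :
    1 - (m : ℝ) ^ 2 / n ≤ n.descFactorial m / (n : ℝ) ^ m := by
  rcases n.eq_zero_or_pos with rfl | hn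
  · simp [Nat.le_zero.1 hmn]
  have hn' : (0 : ℝ) < n := Nat.cast_pos.2 hn
  have hratio : (m : ℝ) / n ≤ 1 := (div_le_one hn').2 (Nat.cast_le.2 hmn)
  have hpow : (n - m) ^ m ≤ n.descFactorial m :=
    (Nat.pow_le_pow_left (by lia) m).trans (Nat.pow_sub_le_descFactorial n m)
  calc 1 - (m : ℝ) ^ 2 / n = 1 + m * (-(m / n)) := by ring
    _ ≤ (1 + -(m / n)) ^ m := one_add_mul_le_pow (by linarith) m
    _ = ((n - m : ℕ) : ℝ) ^ m / (n : ℝ) ^ m := by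
        rw [← div_pow, Nat.cast_sub hmn]
        congr 1
        field_simp
        ring
    _ ≤ n.descFactorial m / (n : ℝ) ^ m := by
        gcongr
        exact_mod_cast hpow

/-- The prefix law is the image of `w` under a uniformly chosen injection `Fin m → Fin n`, the
mixture its image under a uniformly chosen map. -/
theorem IsExchangeable.tvDist_mapLaw_castLE_le {w : (Fin n → Fin k) → ℝ} (hw : IsExchangeable w)
    (hw' : w ∈ stdSimplex ℝ (Fin n → Fin k)) (hmn : m ≤ n) :
    tvDist (mapLaw w (· ∘ Fin.castLE hmn)) (fun y => ∑ s, w s * productLaw (empirical s) m y)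
      ≤ (m : ℝ) ^ 2 / n := by
  set J := (Finset.univ : Finset (Fin m → Fin n)).filter Function.Injective with hJ
  have hJne : J.Nonempty := ⟨Fin.castLE hmn, by simp [hJ, Fin.castLE_injective]⟩
  have hinjective (y : Fin m → Fin k) : mapLaw w (· ∘ Fin.castLE hmn) y
      = ∑ f, uniformLaw J f * mapLaw w (· ∘ f) y := by
    simp only [uniformLaw, ite_mul, zero_mul, Finset.sum_ite_mem, Finset.univ_inter]
    have hconst (f : Fin m → Fin n) (hf : f ∈ J) :
        (J.card : ℝ)⁻¹ * mapLaw w (· ∘ f) y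
          = (J.card : ℝ)⁻¹ * mapLaw w (· ∘ Fin.castLE hmn) y := by
      rw [hw.mapLaw_comp_eq (Finset.mem_filter.1 hf).2 (Fin.castLE_injective hmn)]
    have : (J.card : ℝ) ≠ 0 := Nat.cast_ne_zero.2 hJne.card_pos.ne'
    rw [Finset.sum_congr rfl hconst, Finset.sum_const, nsmul_eq_mul, mul_inv_cancel_left₀ this]
  calc tvDist (mapLaw w (· ∘ Fin.castLE hmn)) (fun y => ∑ s, w s * productLaw (empirical s) m y)
      = tvDist (fun y => ∑ f, uniformLaw J f * mapLaw w (· ∘ f) y)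
          (fun y => ∑ f : Fin m → Fin n, uniformLaw Finset.univ f * mapLaw w (· ∘ f) y) := by
        rw [funext hinjective, funext (sum_mul_productLaw_empirical w)]
    _ ≤ tvDist (uniformLaw J) (uniformLaw Finset.univ) :=
        tvDist_sum_mul_kernel_le (fun f => mapLaw_mem_stdSimplex hw' _) _ _
    _ = 1 - n.descFactorial m / (n : ℝ) ^ m := by
        rw [tvDist_uniformLaw_univ hJne, card_injective]
        simp
    _ ≤ (m : ℝ) ^ 2 / n := by linarith [one_sub_sq_div_le_descFactorial_div hmn]

end Exchangeable

/-! ### The method of types -/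

section Types

variable {n : ℕ}

/-- The number of occurrences of the letter `x` in the sample `s`. -/
def letterCount (s : Fin n → Fin k) (x : Fin k) : ℕ :=
  (Finset.univ.filter fun i => s i = x).card

theorem sum_letterCount (s : Fin n → Fin k) : ∑ x, letterCount s x = n := by
  simpa [letterCount] using (Finset.card_eq_sum_card_fiberwise (f := s) (s := Finset.univ)
    (t := Finset.univ) fun _ _ => Finset.mem_univ _).symm

theorem empirical_eq_letterCount_div (s : Fin n → Fin k) (x : Fin k) :
    empirical s x = letterCount s x / n :=
  rfl

theorem empirical_eq_empirical_iff {s s' : Fin n → Fin k} :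
    empirical s = empirical s' ↔ letterCount s = letterCount s' := by
  rcases n.eq_zero_or_pos with rfl | hn
  · simp [Subsingleton.elim s s']
  · have : (n : ℝ) ≠ 0 := by positivity
    simp [funext_iff, empirical_eq_letterCount_div, div_left_inj' this]

theorem empirical_pos (s : Fin n → Fin k) (i : Fin n) : 0 < empirical s (s i) := by
  have hcount : 0 < letterCount s (s i) := Finset.card_pos.2 ⟨i, by simp⟩
  have hn : 0 < n := i.pos
  rw [empirical_eq_letterCount_div]
  positivity

theorem empirical_comp_perm (s : Fin n → Fin k) (σ : Equiv.Perm (Fin n)) :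
    empirical (s ∘ σ) = empirical s := by
  funext x
  rw [empirical_eq_sum, empirical_eq_sum]
  congr 1
  exact Equiv.sum_comp σ fun i => if s i = x then (1 : ℝ) else 0

theorem exists_comp_perm_eq {s s' : Fin n → Fin k} (h : letterCount s = letterCount s') :
    ∃ σ : Equiv.Perm (Fin n), s' ∘ σ = s := by
  have hfiber (x : Fin k) : Fintype.card {i // s i = x} = Fintype.card {i // s' i = x} := by
    simpa only [Fintype.card_subtype, letterCount] using congr_fun h x
  exact ⟨Equiv.ofFiberEquiv fun x => Fintype.equivOfCardEq (hfiber x),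
    funext fun i => Equiv.ofFiberEquiv_map _ i⟩

theorem card_comp_perm_eq (s : Fin n → Fin k) (τ : Equiv.Perm (Fin n)) :
    (Finset.univ.filter fun σ : Equiv.Perm (Fin n) => s ∘ σ = s ∘ τ).card
      = ∏ x, (letterCount s x).factorial := by
  have hstab := DomMulAct.stabilizer_card s
  simp only [Fintype.card_subtype] at hstab
  refine (Finset.card_equiv (Equiv.mulRight τ⁻¹) fun σ => ?_).trans hstab
  simp [← Function.comp_assoc, Equiv.comp_symm_eq, Equiv.Perm.inv_def]

theorem card_letterCount_eq_mul_prod_factorial (s : Fin n → Fin k) :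
    (Finset.univ.filter fun s' : Fin n → Fin k => letterCount s' = letterCount s).card
      * ∏ x, (letterCount s x).factorial = n.factorial := by
  set T := Finset.univ.filter fun s' : Fin n → Fin k => letterCount s' = letterCount s with hT
  have hmaps (σ : Equiv.Perm (Fin n)) : s ∘ σ ∈ T := by
    simpa [hT] using empirical_eq_empirical_iff.1 (empirical_comp_perm s σ)
  have hfiber (s' : Fin n → Fin k) (hs' : s' ∈ T) :
      (Finset.univ.filter fun σ : Equiv.Perm (Fin n) => s ∘ σ = s').card
        = ∏ x, (letterCount s x).factorial := by
    obtain ⟨τ, rfl⟩ := exists_comp_perm_eq (Finset.mem_filter.1 hs').2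
    exact card_comp_perm_eq s τ
  have hcard := Finset.card_eq_sum_card_fiberwise (s := Finset.univ)
    (f := fun σ : Equiv.Perm (Fin n) => s ∘ σ) (t := T) fun σ _ => hmaps σ
  rw [Finset.sum_congr rfl hfiber, Finset.sum_const, smul_eq_mul, Finset.card_univ,
    Fintype.card_perm, Fintype.card_fin] at hcard
  exact hcard.symm

theorem productLaw_eq_prod_pow (P : Fin k → ℝ) (s : Fin n → Fin k) :
    productLaw P n s = ∏ x, P x ^ letterCount s x := by
  simp only [letterCount, ← Finset.prod_const]
  exact (Finset.prod_fiberwise' _ s P).symm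

theorem sum_comp_eq_mul_sum_empirical (s : Fin n → Fin k) (g : Fin k → ℝ) :
    ∑ i, g (s i) = n * ∑ x, empirical s x * g x := by
  rcases n.eq_zero_or_pos with rfl | hn
  · simp
  · have : (n : ℝ) ≠ 0 := by positivity
    simp only [empirical_eq_sum, div_mul_eq_mul_div, ← Finset.sum_div, Finset.sum_mul]
    rw [mul_div_cancel₀ _ this, Finset.sum_comm]
    simp

theorem productLaw_eq_exp_neg_kl_mul {R : Fin k → ℝ} (hR : ∀ x, 0 < R x) (s : Fin n → Fin k) :
    productLaw R n s = Real.exp (-(n * kl (empirical s) R)) * productLaw (empirical s) n s := by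
  rw [kl, ← sum_comp_eq_mul_sum_empirical s fun x => Real.log (empirical s x / R x),
    ← Finset.sum_neg_distrib, Real.exp_sum, productLaw, productLaw, ← Finset.prod_mul_distrib]
  refine Finset.prod_congr rfl fun i _ => ?_
  have hemp := empirical_pos s i
  rw [Real.exp_neg, Real.exp_log (div_pos hemp (hR _)), inv_div, div_mul_cancel₀ _ hemp.ne']

theorem factorial_mul_pow_le_factorial_mul_pow (c c' : ℕ) :
    c.factorial * c ^ c' ≤ c'.factorial * c ^ c := by
  rcases le_total c' c with h | h
  · calc c.factorial * c ^ c' = c'.factorial * c.descFactorial (c - c') * c ^ c' := by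
          rw [← Nat.factorial_mul_descFactorial (Nat.sub_le c c'), Nat.sub_sub_self h]
      _ ≤ c'.factorial * c ^ (c - c') * c ^ c' := by
          gcongr
          exact Nat.descFactorial_le_pow _ _
      _ = c'.factorial * c ^ c := by rw [mul_assoc, ← pow_add, Nat.sub_add_cancel h]
  · calc c.factorial * c ^ c' = c.factorial * c ^ (c' - c) * c ^ c := by
          rw [mul_assoc, ← pow_add, Nat.sub_add_cancel h]
      _ ≤ c'.factorial * c ^ c := by
          gcongr
          exact Nat.factorial_mul_pow_sub_le_factorial h

end Types

section Prob

variable {n : ℕ} {Q R : Fin k → ℝ} {S S' : Set (Fin n → Fin k)}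

theorem prob_eq_sum_indicator (Q : Fin k → ℝ) (S : Set (Fin n → Fin k)) :
    prob Q S = ∑ s, S.indicator (productLaw Q n) s := by
  classical
  simp [prob, Set.indicator_apply, Finset.sum_filter, productLaw]

theorem prob_nonneg (hQ : ∀ x, 0 ≤ Q x) (S : Set (Fin n → Fin k)) : 0 ≤ prob Q S :=
  Finset.sum_nonneg fun s _ => productLaw_nonneg hQ n s

theorem prob_mono (hQ : ∀ x, 0 ≤ Q x) (h : S ⊆ S') : prob Q S ≤ prob Q S' := by
  simp only [prob_eq_sum_indicator]
  exact Finset.sum_le_sum fun s _ =>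
    Set.indicator_le_indicator_of_subset h (productLaw_nonneg hQ n) s

theorem prob_pos (hQ : ∀ x, 0 < Q x) (hS : S.Nonempty) : 0 < prob Q S := by
  obtain ⟨s, hs⟩ := hS
  exact Finset.sum_pos (fun s _ => productLaw_pos hQ n s) ⟨s, by simpa using hs⟩

theorem prob_univ (hQ : ∑ x, Q x = 1) : prob Q (Set.univ : Set (Fin n → Fin k)) = 1 := by
  simp [prob_eq_sum_indicator, sum_productLaw, hQ]

theorem mem_feasibleTypes {E : Set (Fin k → ℝ)} {P : Fin k → ℝ} :
    P ∈ feasibleTypes E n ↔ P ∈ E ∧ ∃ s : Fin n → Fin k, empirical s = P := by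
  simp [feasibleTypes, and_comm]

theorem sum_prob_inter_empirical_eq (Q : Fin k → ℝ) (S : Set (Fin n → Fin k))
    (E : Set (Fin k → ℝ)) :
    ∑ P ∈ feasibleTypes E n, prob Q (S ∩ {s | empirical s = P})
      = prob Q (S ∩ {s | empirical s ∈ E}) := by
  classical
  simp only [prob_eq_sum_indicator]
  rw [Finset.sum_comm]
  refine Finset.sum_congr rfl fun s _ => ?_
  have hmem : empirical s ∈ feasibleTypes E n ↔ empirical s ∈ E := by
    simp [mem_feasibleTypes]
  by_cases hs : s ∈ S <;> by_cases hE : empirical s ∈ E <;>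
    simp [Set.indicator_apply, hs, hE, hmem]

theorem card_feasibleTypes_le (E : Set (Fin k → ℝ)) (n : ℕ) :
    (feasibleTypes E n).card ≤ (n + 1) ^ k := by
  classical
  have hsub : feasibleTypes E n ⊆ (Finset.univ : Finset (Fin k → Fin (n + 1))).image
      fun c x => ((c x : ℕ) : ℝ) / n := by
    intro P hP
    obtain ⟨s, -, rfl⟩ := Finset.mem_image.1 (Finset.mem_filter.1 hP).1
    have hlt (x : Fin k) : letterCount s x < n + 1 :=
      Nat.lt_succ_of_le ((Finset.card_filter_le _ _).trans (by simp))
    exact Finset.mem_image.2 ⟨fun x => ⟨letterCount s x, hlt x⟩, Finset.mem_univ _, rfl⟩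
  calc (feasibleTypes E n).card ≤ _ := Finset.card_le_card hsub
    _ ≤ Fintype.card (Fin k → Fin (n + 1)) := Finset.card_image_le
    _ = (n + 1) ^ k := by simp

theorem prob_setOf_empirical_eq (P : Fin k → ℝ) (s : Fin n → Fin k) :
    prob P {s' : Fin n → Fin k | empirical s' = empirical s} * ∏ x, (letterCount s x).factorial
      = n.factorial * ∏ x, P x ^ letterCount s x := by
  have hprob : prob P {s' : Fin n → Fin k | empirical s' = empirical s}
      = (Finset.univ.filter fun s' : Fin n → Fin k => letterCount s' = letterCount s).card
        * ∏ x, P x ^ letterCount s x := by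
    rw [prob_eq_sum_indicator, ← nsmul_eq_mul, ← Finset.sum_const, Finset.sum_filter]
    refine Finset.sum_congr rfl fun s' _ => ?_
    by_cases hs' : letterCount s' = letterCount s
    · simp [hs', empirical_eq_empirical_iff, productLaw_eq_prod_pow]
    · simp [hs', empirical_eq_empirical_iff]
  rw [hprob, ← card_letterCount_eq_mul_prod_factorial s]
  push_cast
  ring

theorem prob_empirical_eq_le_prob_empirical_eq_self (s s' : Fin n → Fin k) :
    prob (empirical s) {t : Fin n → Fin k | empirical t = empirical s'}
      ≤ prob (empirical s) {t : Fin n → Fin k | empirical t = empirical s} := by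
  have hpow (t : Fin n → Fin k) : ∏ x, empirical s x ^ letterCount t x
      = (∏ x, (letterCount s x : ℝ) ^ letterCount t x) / n ^ n := by
    simp only [empirical_eq_letterCount_div, div_pow, Finset.prod_div_distrib,
      Finset.prod_pow_eq_pow_sum, sum_letterCount]
  have hcounts :
      (∏ x, ((letterCount s x).factorial : ℝ)) * ∏ x, (letterCount s x : ℝ) ^ letterCount s' x
        ≤ (∏ x, ((letterCount s' x).factorial : ℝ))
          * ∏ x, (letterCount s x : ℝ) ^ letterCount s x := by
    simp only [← Finset.prod_mul_distrib]
    exact_mod_cast Finset.prod_le_prod' fun x _ =>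
      factorial_mul_pow_le_factorial_mul_pow (letterCount s x) (letterCount s' x)
  have hs := prob_setOf_empirical_eq (empirical s) s
  have hs' := prob_setOf_empirical_eq (empirical s) s'
  rw [hpow] at hs hs'
  push_cast at hs hs'
  have hpos (t : Fin n → Fin k) : 0 < ∏ x, ((letterCount t x).factorial : ℝ) := by positivity
  rw [eq_div_of_mul_eq (hpos _).ne' hs, eq_div_of_mul_eq (hpos _).ne' hs',
    div_le_div_iff₀ (hpos _) (hpos _)]
  calc _ = n.factorial / n ^ n * ((∏ x, ((letterCount s x).factorial : ℝ)) *
            ∏ x, (letterCount s x : ℝ) ^ letterCount s' x) := by ring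
    _ ≤ n.factorial / n ^ n * ((∏ x, ((letterCount s' x).factorial : ℝ)) *
            ∏ x, (letterCount s x : ℝ) ^ letterCount s x) := by gcongr
    _ = _ := by ring

theorem one_le_mul_prob_empirical_eq_self (hn : 0 < n) (s : Fin n → Fin k) :
    1 ≤ ((n : ℝ) + 1) ^ k * prob (empirical s) {t : Fin n → Fin k | empirical t = empirical s} := by
  have hemp := empirical_mem_stdSimplex hn s
  calc (1 : ℝ) = prob (empirical s) (Set.univ : Set (Fin n → Fin k)) := (prob_univ hemp.2).symm
    _ = ∑ P ∈ feasibleTypes Set.univ n,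
          prob (empirical s) {t : Fin n → Fin k | empirical t = P} := by
        simpa using (sum_prob_inter_empirical_eq (empirical s) Set.univ Set.univ).symm
    _ ≤ (feasibleTypes (Set.univ : Set (Fin k → ℝ)) n).card
          • prob (empirical s) {t : Fin n → Fin k | empirical t = empirical s} := by
        refine Finset.sum_le_card_nsmul _ _ _ fun P hP => ?_
        obtain ⟨-, s', rfl⟩ := mem_feasibleTypes.1 hP
        exact prob_empirical_eq_le_prob_empirical_eq_self s s'
    _ ≤ _ := by
        rw [nsmul_eq_mul]
        have hcard := card_feasibleTypes_le (Set.univ : Set (Fin k → ℝ)) n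
        gcongr
        · exact prob_nonneg hemp.1 _
        · exact_mod_cast hcard

theorem prob_empirical_eq_eq_exp_mul (hR : ∀ x, 0 < R x) (s : Fin n → Fin k) :
    prob R {t : Fin n → Fin k | empirical t = empirical s} = Real.exp (-(n * kl (empirical s) R))
      * prob (empirical s) {t : Fin n → Fin k | empirical t = empirical s} := by
  rw [prob_eq_sum_indicator, prob_eq_sum_indicator, Finset.mul_sum]
  refine Finset.sum_congr rfl fun t _ => ?_
  by_cases ht : empirical t = empirical s
  · simp [ht, productLaw_eq_exp_neg_kl_mul hR t]
  · simp [ht]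

theorem exp_neg_kl_le_mul_prob_empirical_eq (hR : ∀ x, 0 < R x) (hn : 0 < n) (s : Fin n → Fin k) :
    Real.exp (-(n * kl (empirical s) R))
      ≤ ((n : ℝ) + 1) ^ k * prob R {t : Fin n → Fin k | empirical t = empirical s} := by
  rw [prob_empirical_eq_eq_exp_mul hR, mul_left_comm]
  exact le_mul_of_one_le_right (Real.exp_pos _).le (one_le_mul_prob_empirical_eq_self hn s)

theorem prob_empirical_eq_le_exp_neg_kl (hR : ∀ x, 0 < R x) (hn : 0 < n) (s : Fin n → Fin k) :
    prob R {t : Fin n → Fin k | empirical t = empirical s}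
      ≤ Real.exp (-(n * kl (empirical s) R)) := by
  have hemp := empirical_mem_stdSimplex hn s
  rw [prob_empirical_eq_eq_exp_mul hR]
  refine mul_le_of_le_one_right (Real.exp_pos _).le ?_
  exact (prob_mono hemp.1 (Set.subset_univ _)).trans_eq (prob_univ hemp.2)

theorem prob_empirical_mem_le (hR : ∀ x, 0 < R x) (hn : 0 < n) {A : Set (Fin k → ℝ)} {M : ℝ}
    (hA : ∀ s : Fin n → Fin k, empirical s ∈ A → M ≤ kl (empirical s) R) :
    prob R {s : Fin n → Fin k | empirical s ∈ A} ≤ ((n : ℝ) + 1) ^ k * Real.exp (-(n * M)) := by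
  calc prob R {s : Fin n → Fin k | empirical s ∈ A}
      = ∑ P ∈ feasibleTypes A n, prob R {s : Fin n → Fin k | empirical s = P} := by
        simpa using (sum_prob_inter_empirical_eq R Set.univ A).symm
    _ ≤ (feasibleTypes A n).card • Real.exp (-(n * M)) := by
        refine Finset.sum_le_card_nsmul _ _ _ fun P hP => ?_
        obtain ⟨hPA, s, rfl⟩ := mem_feasibleTypes.1 hP
        refine (prob_empirical_eq_le_exp_neg_kl hR hn s).trans ?_
        gcongr
        exact hA s hPA
    _ ≤ _ := by
        rw [nsmul_eq_mul]
        have hcard := card_feasibleTypes_le A n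
        gcongr
        exact_mod_cast hcard

theorem condProb_empirical_mem_le (hR : ∀ x, 0 < R x) (hn : 0 < n) {A E : Set (Fin k → ℝ)} {M : ℝ}
    (hA : ∀ s : Fin n → Fin k, empirical s ∈ A ∩ E → M ≤ kl (empirical s) R)
    {s₀ : Fin n → Fin k} (hs₀ : empirical s₀ ∈ E) :
    condProb R {s : Fin n → Fin k | empirical s ∈ A} {s | empirical s ∈ E}
      ≤ ((n : ℝ) + 1) ^ (2 * k) * Real.exp (n * kl (empirical s₀) R - n * M) := by
  have hE : Real.exp (-(n * kl (empirical s₀) R))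
      ≤ ((n : ℝ) + 1) ^ k * prob R {s : Fin n → Fin k | empirical s ∈ E} := by
    refine (exp_neg_kl_le_mul_prob_empirical_eq hR hn s₀).trans ?_
    gcongr
    refine prob_mono (fun x => (hR x).le) fun t (ht : empirical t = empirical s₀) => ?_
    exact Set.mem_ofPred_eq ▸ ht ▸ hs₀
  rw [condProb, div_le_iff₀ (prob_pos hR ⟨s₀, hs₀⟩)]
  calc prob R {s : Fin n → Fin k | empirical s ∈ A ∩ E}
      ≤ ((n : ℝ) + 1) ^ k * Real.exp (-(n * M)) := prob_empirical_mem_le hR hn hA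
    _ = ((n : ℝ) + 1) ^ k * Real.exp (n * kl (empirical s₀) R - n * M)
          * Real.exp (-(n * kl (empirical s₀) R)) := by
        rw [mul_assoc, ← Real.exp_add]
        ring_nf
    _ ≤ ((n : ℝ) + 1) ^ k * Real.exp (n * kl (empirical s₀) R - n * M)
          * (((n : ℝ) + 1) ^ k * prob R {s : Fin n → Fin k | empirical s ∈ E}) := by gcongr
    _ = _ := by ring

end Prob

/-! ### Types near an interior point of the constraint set -/

section Lattice

theorem exists_norm_sub_le_of_mem_span {V : Type*} [SeminormedAddCommGroup V] [NormedSpace ℝ V]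
    {L : AddSubgroup V} (hL : (Submodule.span ℝ (L : Set V)).FG) :
    ∃ B : ℝ, ∀ v ∈ Submodule.span ℝ (L : Set V), ∃ u ∈ L, ‖v - u‖ ≤ B := by
  obtain ⟨F, hFL, hspan⟩ := (Submodule.fg_span_iff_fg_span_finset_subset _).1 hL
  refine ⟨∑ a ∈ F, ‖a‖, fun v hv => ?_⟩
  obtain ⟨c, -, rfl⟩ := Submodule.mem_span_finset.1 (hspan ▸ hv)
  refine ⟨∑ a ∈ F, ⌊c a⌋ • a, sum_mem fun a ha => zsmul_mem (hFL ha) _, ?_⟩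
  have hfract : ∑ a ∈ F, c a • a - ∑ a ∈ F, ⌊c a⌋ • a = ∑ a ∈ F, Int.fract (c a) • a := by
    simp only [← Finset.sum_sub_distrib, ← Int.cast_smul_eq_zsmul ℝ, ← sub_smul,
      Int.self_sub_floor]
  rw [hfract]
  refine norm_sum_le_of_le _ fun a _ => ?_
  rw [norm_smul, Real.norm_of_nonneg (Int.fract_nonneg _)]
  exact mul_le_of_le_one_left (norm_nonneg a) (Int.fract_lt_one _).le

/-- The lattice of integer vectors of the tangent space, whose linear span is the whole tangent
space exactly when `IsLatticeConstraint h` holds. -/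
def integerTangent (h : Fin k → Fin d → ℝ) : AddSubgroup (EuclideanSpace ℝ (Fin k)) where
  carrier := {v | v ∈ tangent h ∧ ∀ x, ∃ z : ℤ, v x = z}
  zero_mem' := ⟨zero_mem _, fun _ => ⟨0, by simp⟩⟩
  add_mem' := by
    rintro v w ⟨hv, hvz⟩ ⟨hw, hwz⟩
    refine ⟨add_mem hv hw, fun x => ?_⟩
    obtain ⟨y, hy⟩ := hvz x
    obtain ⟨z, hz⟩ := hwz x
    exact ⟨y + z, by simp [hy, hz]⟩
  neg_mem' := by
    rintro v ⟨hv, hvz⟩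
    refine ⟨neg_mem hv, fun x => ?_⟩
    obtain ⟨z, hz⟩ := hvz x
    exact ⟨-z, by simp [hz]⟩

variable {n : ℕ}

theorem exists_letterCount_eq (c : Fin k → ℕ) (hc : ∑ x, c x = n) :
    ∃ s : Fin n → Fin k, letterCount s = c := by
  have e : Fin n ≃ Σ x, Fin (c x) := Fintype.equivOfCardEq (by simp [hc])
  refine ⟨fun i => (e i).1, funext fun x => ?_⟩
  rw [letterCount, ← Fintype.card_subtype, Fintype.card_congr
    (e.subtypeEquiv (q := fun a => a.1 = x) fun i => Iff.rfl),
    Fintype.card_congr (Equiv.sigmaSubtype x), Fintype.card_fin]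

theorem exists_empirical_eq_add_smul (hn : 0 < n) (s : Fin n → Fin k) {u : Fin k → ℝ}
    (hsum : ∑ x, u x = 0) (hu : ∀ x, ∃ z : ℤ, u x = z)
    (hpos : ∀ x, 0 ≤ empirical s x + (n : ℝ)⁻¹ * u x) :
    ∃ s' : Fin n → Fin k, empirical s' = fun x => empirical s x + (n : ℝ)⁻¹ * u x := by
  have hn' : (0 : ℝ) < n := Nat.cast_pos.2 hn
  choose z hz using hu
  have hshift (x : Fin k) :
      empirical s x + (n : ℝ)⁻¹ * u x = ((letterCount s x + z x : ℤ) : ℝ) / n := by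
    rw [empirical_eq_letterCount_div, hz]
    push_cast
    ring
  have hnonneg (x : Fin k) : 0 ≤ (letterCount s x + z x : ℤ) := by
    simpa only [hshift, le_div_iff₀ hn', zero_mul, Int.cast_nonneg_iff] using hpos x
  choose c hc using fun x => Int.eq_ofNat_of_zero_le (hnonneg x)
  have hcsum : ∑ x, c x = n := by
    have hzsum : ∑ x, z x = 0 := by
      simp only [hz] at hsum
      exact_mod_cast hsum
    have hcount : ∑ x, (letterCount s x : ℤ) = n := by exact_mod_cast sum_letterCount s
    zify
    rw [← Finset.sum_congr rfl fun x _ => hc x, Finset.sum_add_distrib, hzsum, hcount, add_zero]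
  obtain ⟨s', hs'⟩ := exists_letterCount_eq c hcsum
  refine ⟨s', funext fun x => ?_⟩
  rw [hshift, hc, empirical_eq_letterCount_div, hs']
  rfl

theorem IsLatticeConstraint.exists_norm_toLp_empirical_sub_le {h : Fin k → Fin d → ℝ}
    (hlat : IsLatticeConstraint h) :
    ∃ B : ℝ, ∀ (a : Fin d → ℝ) (n : ℕ) (R : Fin k → ℝ), 0 < n → R ∈ constraintSet h a →
      (feasibleTypes (constraintSet h a) n).Nonempty → (∀ x, B / n < R x) →
      ∃ s : Fin n → Fin k, empirical s ∈ constraintSet h a ∧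
        ‖WithLp.toLp 2 (empirical s - R)‖ ≤ B / n := by
  have hspan : Submodule.span ℝ (integerTangent h : Set (EuclideanSpace ℝ (Fin k))) = tangent h :=
    hlat
  obtain ⟨B, hround⟩ :=
    exists_norm_sub_le_of_mem_span (L := integerTangent h) (IsNoetherian.noetherian _)
  refine ⟨B, fun a n R hn hR hne hBR => ?_⟩
  have : (0 : ℝ) < n := Nat.cast_pos.2 hn
  obtain ⟨_, hP⟩ := hne
  obtain ⟨hsE, s, rfl⟩ := mem_feasibleTypes.1 hP
  obtain ⟨u, ⟨hu, huz⟩, huB⟩ := hround ((n : ℝ) • WithLp.toLp 2 (R - empirical s))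
    (hspan ▸ Submodule.smul_mem _ _ (toLp_sub_mem_tangent hR hsE))
  have hclose : ‖WithLp.toLp 2 ((fun x => empirical s x + (n : ℝ)⁻¹ * u x) - R)‖ ≤ B / n := by
    have hscale : WithLp.toLp 2 ((fun x => empirical s x + (n : ℝ)⁻¹ * u x) - R)
        = (-(n : ℝ)⁻¹) • ((n : ℝ) • WithLp.toLp 2 (R - empirical s) - u) := by
      ext x
      simp only [Pi.sub_apply, PiLp.smul_apply, PiLp.sub_apply, smul_eq_mul]
      field_simp
      ring
    rw [hscale, norm_smul, norm_neg, norm_inv, Real.norm_natCast, div_eq_inv_mul]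
    gcongr
  have hpos (x : Fin k) : 0 < empirical s x + (n : ℝ)⁻¹ * u x := by
    have hx := (PiLp.norm_apply_le _ x).trans hclose
    have hxR := (abs_le.1 hx).1
    simp only [Pi.sub_apply] at hxR
    linarith [hBR x]
  obtain ⟨s', hs'⟩ := exists_empirical_eq_add_smul hn s hu.1 huz fun x => (hpos x).le
  exact ⟨s', hs' ▸ add_smul_mem_constraintSet hsE hu hpos, hs' ▸ hclose⟩

theorem exists_pos_forall_le {R : Fin k → ℝ} (hR : ∀ x, 0 < R x) : ∃ p > 0, ∀ x, p ≤ R x := by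
  obtain ⟨p, hp, hpR⟩ := Pi.exists_forall_pos_add_lt hR
  exact ⟨p, hp, fun x => by simpa using (hpR x).le⟩

theorem IsLatticeConstraint.eventually_exists_mul_kl_le {h : Fin k → Fin d → ℝ}
    (hlat : IsLatticeConstraint h) {a : Fin d → ℝ} {R : Fin k → ℝ} (hR : R ∈ constraintSet h a)
    {ε : ℝ} (hε : 0 < ε) :
    ∀ᶠ n in feasibleAtTop (constraintSet h a), ∃ s : Fin n → Fin k,
      empirical s ∈ constraintSet h a ∧ n * kl (empirical s) R ≤ ε := by
  obtain ⟨B, hB⟩ := hlat.exists_norm_toLp_empirical_sub_le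
  obtain ⟨p, hp, hpR⟩ := exists_pos_forall_le hR.1
  have hclose : ∀ᶠ n : ℕ in atTop, B / n < p :=
    (tendsto_const_div_atTop_nhds_zero_nat B).eventually_lt_const hp
  have hsmall : ∀ᶠ n : ℕ in atTop, B ^ 2 / p / n ≤ ε :=
    (tendsto_const_div_atTop_nhds_zero_nat _).eventually_le_const hε
  rw [feasibleAtTop, eventually_inf_principal]
  filter_upwards [hclose, hsmall, eventually_gt_atTop 0] with n hnp hnε hn hne
  obtain ⟨s, hsE, hs⟩ := hB a n R hn hR hne fun x => hnp.trans_le (hpR x)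
  refine ⟨s, hsE, le_trans ?_ hnε⟩
  have : (0 : ℝ) < n := Nat.cast_pos.2 hn
  have hsq : ∑ x, (empirical s x - R x) ^ 2 ≤ (B / n) ^ 2 := by
    have hnorm := pow_le_pow_left₀ (norm_nonneg _) hs 2
    simpa [EuclideanSpace.real_norm_sq_eq] using hnorm
  calc n * kl (empirical s) R
      ≤ n * ∑ x, (empirical s x - R x) ^ 2 / R x := by
        gcongr
        exact kl_le_sum_sq_div (fun x => (hsE.1 x).le) hR.1 (hsE.2.1.trans hR.2.1.symm)
    _ ≤ n * ∑ x, (empirical s x - R x) ^ 2 / p := by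
        gcongr with x
        exact hpR x
    _ ≤ n * ((B / n) ^ 2 / p) := by
        rw [← Finset.sum_div]
        gcongr
    _ = B ^ 2 / p / n := by field_simp

end Lattice

/-! ### The smallest eigenvalue of the projected Hessian -/

section LambdaMin

variable {V : Type*} [NormedAddCommGroup V] [InnerProductSpace ℝ V] [FiniteDimensional ℝ V]
  {H : V →ₗ[ℝ] V}

theorem hasEigenvalue_lambdaMin [Nontrivial V] (hH : H.IsSymmetric) :
    Module.End.HasEigenvalue H (lambdaMin H) :=
  Set.Nonempty.csInf_mem ⟨_, hH.hasEigenvalue_iInf_of_finiteDimensional⟩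
    (Module.End.finite_hasEigenvalue H)

theorem lambdaMin_mul_norm_sq_le_inner (hH : H.IsSymmetric) (v : V) :
    lambdaMin H * ‖v‖ ^ 2 ≤ inner ℝ (H v) v := by
  set b := hH.eigenvectorBasis rfl
  have hle (i) : lambdaMin H ≤ hH.eigenvalues rfl i :=
    csInf_le (Module.End.finite_hasEigenvalue H).bddBelow (hH.hasEigenvalue_eigenvalues rfl i)
  have hinner (i) : inner ℝ (H v) (b i) = hH.eigenvalues rfl i * inner ℝ v (b i) := by
    rw [hH v (b i), hH.apply_eigenvectorBasis rfl i]
    exact inner_smul_right _ _ _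
  rw [← real_inner_self_eq_norm_sq, ← b.sum_inner_mul_inner v v, ← b.sum_inner_mul_inner (H v) v,
    Finset.mul_sum]
  refine Finset.sum_le_sum fun i _ => ?_
  rw [hinner, mul_assoc, real_inner_comm v (b i)]
  exact mul_le_mul_of_nonneg_right (hle i) (mul_self_nonneg _)

end LambdaMin

section ProjHessian

variable (T : Submodule ℝ (EuclideanSpace ℝ (Fin k))) {R : Fin k → ℝ}

theorem inner_projHessian (R : Fin k → ℝ) (v w : T) :
    inner ℝ (projHessian T R v) w = ∑ x, (v : EuclideanSpace ℝ (Fin k)) x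
      * (w : EuclideanSpace ℝ (Fin k)) x / R x := by
  refine (T.inner_orthogonalProjectionOnto_eq_of_mem_right w _).trans ?_
  rw [PiLp.inner_apply]
  refine Finset.sum_congr rfl fun x _ => ?_
  simp [Matrix.mulVec_diagonal]
  ring

theorem isSymmetric_projHessian (R : Fin k → ℝ) : (projHessian T R).IsSymmetric := fun v w => by
  simp only [real_inner_comm (projHessian T R w) v, inner_projHessian, mul_comm]

theorem lambdaMin_projHessian_pos (hT : T ≠ ⊥) (hR : ∀ x, 0 < R x) :
    0 < lambdaMin (projHessian T R) := by
  have := Submodule.nontrivial_iff_ne_bot.2 hT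
  obtain ⟨v, hv⟩ := (hasEigenvalue_lambdaMin (isSymmetric_projHessian T R)).exists_hasEigenvector
  have hpos : 0 < inner ℝ (projHessian T R v) v := by
    obtain ⟨x, hx⟩ : ∃ x, (v : EuclideanSpace ℝ (Fin k)) x ≠ 0 := by
      by_contra! hzero
      exact hv.2 (Subtype.ext (WithLp.ofLp_injective 2 (funext hzero)))
    rw [inner_projHessian]
    have hterm (y : Fin k) : 0 ≤ (v : EuclideanSpace ℝ (Fin k)) y
        * (v : EuclideanSpace ℝ (Fin k)) y / R y := div_nonneg (mul_self_nonneg _) (hR y).le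
    exact Finset.sum_pos' (fun y _ => hterm y)
      ⟨x, Finset.mem_univ x, div_pos (mul_self_pos.2 hx) (hR x)⟩
  rw [hv.apply_eq_smul, inner_smul_left, real_inner_self_eq_norm_sq] at hpos
  exact pos_of_mul_pos_left hpos (sq_nonneg _)

theorem lambdaMin_projHessian_mul_sum_sq_le (R : Fin k → ℝ) {v : Fin k → ℝ}
    (hv : WithLp.toLp 2 v ∈ T) :
    lambdaMin (projHessian T R) * ∑ x, v x ^ 2 ≤ ∑ x, v x ^ 2 / R x := by
  have hle := lambdaMin_mul_norm_sq_le_inner (isSymmetric_projHessian T R) ⟨_, hv⟩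
  rw [inner_projHessian, Submodule.coe_norm, EuclideanSpace.real_norm_sq_eq] at hle
  simpa only [sq] using hle

end ProjHessian

/-! ### The predictive law as an exchangeable mixture -/

section ConditionalLaw

variable {n m : ℕ} {R : Fin k → ℝ} {A : Set (Fin n → Fin k)}

/-- The law of a sample of size `n` from `R`, conditioned on the event `A`. -/
noncomputable def conditionalLaw (R : Fin k → ℝ) (A : Set (Fin n → Fin k)) (s : Fin n → Fin k) :
    ℝ :=
  A.indicator (productLaw R n) s / prob R A

theorem condProb_eq_sum_indicator (R : Fin k → ℝ) (S A : Set (Fin n → Fin k)) :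
    condProb R S A = ∑ s, S.indicator (conditionalLaw R A) s := by
  rw [condProb, prob_eq_sum_indicator, Finset.sum_div]
  refine Finset.sum_congr rfl fun s _ => ?_
  by_cases hs : s ∈ S <;> by_cases hA : s ∈ A <;> simp [conditionalLaw, hs, hA]

theorem conditionalLaw_mem_stdSimplex (hR : ∀ x, 0 < R x) (hA : A.Nonempty) :
    conditionalLaw R A ∈ stdSimplex ℝ (Fin n → Fin k) := by
  refine ⟨fun s => div_nonneg (Set.indicator_nonneg (fun s _ => (productLaw_pos hR n s).le) s)
    (prob_pos hR hA).le, ?_⟩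
  simp only [conditionalLaw]
  rw [← Finset.sum_div, ← prob_eq_sum_indicator, div_self (prob_pos hR hA).ne']

theorem isExchangeable_conditionalLaw (R : Fin k → ℝ) (E : Set (Fin k → ℝ)) :
    IsExchangeable (conditionalLaw R {s : Fin n → Fin k | empirical s ∈ E}) := fun σ s => by
  have hprod : productLaw R n (s ∘ σ) = productLaw R n s := Equiv.prod_comp σ fun i => R (s i)
  by_cases hs : empirical s ∈ E <;>
    simp [conditionalLaw, hs, empirical_comp_perm, hprod]

theorem condProb_prefixEvent (R : Fin k → ℝ) (A : Set (Fin n → Fin k)) (hmn : m ≤ n)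
    (y : Fin m → Fin k) :
    condProb R (prefixEvent n y) A = mapLaw (conditionalLaw R A) (· ∘ Fin.castLE hmn) y := by
  have hmem (s : Fin n → Fin k) : s ∈ prefixEvent n y ↔ s ∘ Fin.castLE hmn = y :=
    ⟨fun hs => funext fun j => hs _ j rfl, by
      rintro rfl i j hij
      exact congrArg s (Fin.ext hij)⟩
  rw [condProb_eq_sum_indicator, mapLaw, Finset.sum_filter]
  refine Finset.sum_congr rfl fun s _ => ?_
  by_cases hs : s ∘ Fin.castLE hmn = y <;> simp [hmem, hs]

end ConditionalLaw

section Predictive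

variable {n m : ℕ}

theorem predictive_eq_condProb {Q : Fin k → ℝ} (hQ : ∀ x, 0 < Q x) (E : Set (Fin k → ℝ))
    (y : Fin m → Fin k) :
    predictive Q E n m y = condProb Q (prefixEvent n y) {s | empirical s ∈ E} := by
  rw [predictive, condProb, ← sum_prob_inter_empirical_eq, Finset.sum_div]
  refine Finset.sum_congr rfl fun P hP => ?_
  obtain ⟨hPE, s, rfl⟩ := mem_feasibleTypes.1 hP
  have hsub : {t : Fin n → Fin k | empirical t = empirical s} ⊆ {t | empirical t ∈ E} :=
    fun t (ht : empirical t = empirical s) => Set.mem_ofPred_eq ▸ ht ▸ hPE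
  have hpos : 0 < prob Q {t : Fin n → Fin k | empirical t = empirical s} := prob_pos hQ ⟨s, rfl⟩
  rw [condProb, condProb, Set.inter_eq_left.2 hsub, div_mul_div_cancel₀ hpos.ne']

variable {h : Fin k → Fin d → ℝ} {a : Fin d → ℝ} {Q R : Fin k → ℝ}

/-- By the Pythagorean identity the density of `Q` with respect to its information projection is
constant on the samples whose type satisfies the constraints. -/
theorem IsInfoProj.productLaw_eq (hQ : ∀ x, 0 < Q x) (hR : IsInfoProj Q (constraintSet h a) R)
    {s : Fin n → Fin k} (hs : empirical s ∈ constraintSet h a) :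
    productLaw Q n s = Real.exp (-(n * kl R Q)) * productLaw R n s := by
  rw [← hR.sum_mul_log_eq_kl hQ hs, ← sum_comp_eq_mul_sum_empirical s fun x => Real.log (R x / Q x),
    ← Finset.sum_neg_distrib, Real.exp_sum, productLaw, productLaw, ← Finset.prod_mul_distrib]
  refine Finset.prod_congr rfl fun i _ => ?_
  rw [Real.exp_neg, Real.exp_log (div_pos (hR.1.1 _) (hQ _)), inv_div,
    div_mul_cancel₀ _ (hR.1.1 _).ne']

theorem IsInfoProj.condProb_eq (hQ : ∀ x, 0 < Q x) (hR : IsInfoProj Q (constraintSet h a) R)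
    (S : Set (Fin n → Fin k)) :
    condProb Q S {s | empirical s ∈ constraintSet h a}
      = condProb R S {s | empirical s ∈ constraintSet h a} := by
  have hprob (S : Set (Fin n → Fin k)) (hS : S ⊆ {s | empirical s ∈ constraintSet h a}) :
      prob Q S = Real.exp (-(n * kl R Q)) * prob R S := by
    rw [prob_eq_sum_indicator, prob_eq_sum_indicator, Finset.mul_sum]
    refine Finset.sum_congr rfl fun s _ => ?_
    by_cases hs : s ∈ S
    · simp [hs, hR.productLaw_eq hQ (hS hs)]
    · simp [hs]
  rw [condProb, condProb, hprob _ Set.inter_subset_right, hprob _ subset_rfl,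
    mul_div_mul_left _ _ (Real.exp_pos _).ne']

theorem IsInfoProj.predictive_eq_mapLaw (hQ : ∀ x, 0 < Q x)
    (hR : IsInfoProj Q (constraintSet h a) R) (hmn : m ≤ n) :
    predictive Q (constraintSet h a) n m
      = mapLaw (conditionalLaw R {s : Fin n → Fin k | empirical s ∈ constraintSet h a})
          (· ∘ Fin.castLE hmn) :=
  funext fun y => by
    rw [predictive_eq_condProb hQ, hR.condProb_eq hQ, condProb_prefixEvent R _ hmn]

end Predictive

section Concentration

variable {n : ℕ} {R : Fin k → ℝ}

theorem tvDist_empirical_le_sqrt_add_indicator (hn : 0 < n) (hR : R ∈ stdSimplex ℝ (Fin k))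
    (ρ : ℝ) (s : Fin n → Fin k) :
    tvDist (empirical s) R ≤ 1 / 2 * √(k * ρ)
      + {s : Fin n → Fin k | ρ ≤ ∑ x, (empirical s x - R x) ^ 2}.indicator 1 s := by
  by_cases hs : ρ ≤ ∑ x, (empirical s x - R x) ^ 2
  · have hone := tvDist_le_one (empirical_mem_stdSimplex hn s) hR
    have : 0 ≤ 1 / 2 * √(k * ρ) := by positivity
    simpa [hs] using hone.trans (le_add_of_nonneg_left this)
  · have hsqrt := tvDist_le_sqrt (empirical s) R
    rw [Fintype.card_fin] at hsqrt
    simp only [Set.indicator_apply, Set.mem_ofPred_eq, hs, if_false, add_zero]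
    refine hsqrt.trans ?_
    gcongr
    exact (not_le.1 hs).le

theorem tvDist_sum_conditionalLaw_mul_productLaw_le (hn : 0 < n) (hpos : ∀ x, 0 < R x)
    (hsum : ∑ x, R x = 1) {A : Set (Fin n → Fin k)} (hA : A.Nonempty) (m : ℕ) (ρ : ℝ) :
    tvDist (fun y => ∑ s, conditionalLaw R A s * productLaw (empirical s) m y) (productLaw R m)
      ≤ m * (1 / 2 * √(k * ρ) + condProb R {s | ρ ≤ ∑ x, (empirical s x - R x) ^ 2} A) := by
  have hRmem : R ∈ stdSimplex ℝ (Fin k) := ⟨fun x => (hpos x).le, hsum⟩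
  have hlaw := conditionalLaw_mem_stdSimplex hpos hA
  have hconst : productLaw R m = fun y => ∑ s, conditionalLaw R A s * productLaw R m y := by
    simp only [← Finset.sum_mul, hlaw.2, one_mul]
  rw [hconst]
  refine (tvDist_sum_mul_le hlaw.1 _ _).trans ?_
  calc ∑ s, conditionalLaw R A s * tvDist (productLaw (empirical s) m) (productLaw R m)
      ≤ ∑ s, conditionalLaw R A s * (m * (1 / 2 * √(k * ρ)
          + {s | ρ ≤ ∑ x, (empirical s x - R x) ^ 2}.indicator 1 s)) := by
        gcongr with s
        · exact hlaw.1 s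
        · refine (tvDist_productLaw_le (empirical_mem_stdSimplex hn s) hRmem m).trans ?_
          gcongr
          exact tvDist_empirical_le_sqrt_add_indicator hn hRmem ρ s
    _ = (∑ s, conditionalLaw R A s) * (m * (1 / 2 * √(k * ρ)))
          + m * ∑ s, conditionalLaw R A s
            * {s | ρ ≤ ∑ x, (empirical s x - R x) ^ 2}.indicator 1 s := by
        rw [Finset.sum_mul, Finset.mul_sum, ← Finset.sum_add_distrib]
        exact Finset.sum_congr rfl fun s _ => by ring
    _ = _ := by
        rw [hlaw.2, one_mul, mul_add, condProb_eq_sum_indicator]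
        simp [Set.indicator_apply]

end Concentration

/-! ### The rate -/

section Rate

variable {n m : ℕ} {h : Fin k → Fin d → ℝ} {a : Fin d → ℝ} {Q R : Fin k → ℝ}

theorem IsInfoProj.tvDist_predictive_le (hQ : ∀ x, 0 < Q x)
    (hR : IsInfoProj Q (constraintSet h a) R) (hn : 0 < n) (hmn : m ≤ n)
    (hne : {s : Fin n → Fin k | empirical s ∈ constraintSet h a}.Nonempty) (ρ : ℝ) :
    tvDist (predictive Q (constraintSet h a) n m) (productLaw R m)
      ≤ (m : ℝ) ^ 2 / n + m * (1 / 2 * √(k * ρ)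
        + condProb R {s : Fin n → Fin k | ρ ≤ ∑ x, (empirical s x - R x) ^ 2}
            {s | empirical s ∈ constraintSet h a}) := by
  rw [hR.predictive_eq_mapLaw hQ hmn]
  refine (tvDist_triangle _ _ _).trans (add_le_add
    ((isExchangeable_conditionalLaw R _).tvDist_mapLaw_castLE_le
      (conditionalLaw_mem_stdSimplex hR.1.1 hne) hmn) ?_)
  exact tvDist_sum_conditionalLaw_mul_productLaw_le hn hR.1.1 hR.1.2.1 hne m ρ

theorem condProb_le_sum_sq_empirical_sub_le (hT : tangent h ≠ ⊥) (hR : R ∈ constraintSet h a)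
    {p : ℝ} (hp : 0 < p) (hpR : ∀ x, p ≤ R x) (hn : 0 < n) {s₀ : Fin n → Fin k}
    (hs₀ : empirical s₀ ∈ constraintSet h a) (ρ : ℝ) :
    condProb R {s : Fin n → Fin k | ρ ≤ ∑ x, (empirical s x - R x) ^ 2}
        {s | empirical s ∈ constraintSet h a}
      ≤ ((n : ℝ) + 1) ^ (2 * k) * Real.exp (n * kl (empirical s₀) R
        - n * min (p ^ 2 / 4) (lambdaMin (projHessian (tangent h) R) / 6 * ρ)) := by
  refine condProb_empirical_mem_le hR.1 hn (A := {P | ρ ≤ ∑ x, (P x - R x) ^ 2}) ?_ hs₀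
  rintro s ⟨hsρ, hsE⟩
  have hlam := lambdaMin_projHessian_pos _ hT hR.1
  have hcoercive := lambdaMin_projHessian_mul_sum_sq_le _ R (toLp_sub_mem_tangent hsE hR)
  refine le_trans ?_ (min_le_kl (empirical_mem_stdSimplex hn s)
    ⟨fun x => (hR.1 x).le, hR.2.1⟩ hp hpR hcoercive)
  gcongr
  exact hsρ

theorem add_one_pow_mul_exp_sub_log_le (k : ℕ) (hn : 0 < n) :
    ((n : ℝ) + 1) ^ (2 * k) * Real.exp (1 - 2 * (k + 1) * Real.log n)
      ≤ Real.exp 1 * 4 ^ k * ((n : ℝ) ^ 2)⁻¹ := by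
  have hn' : (0 : ℝ) < n := Nat.cast_pos.2 hn
  have hn1 : (1 : ℝ) ≤ n := Nat.one_le_cast.2 hn
  have hexp : Real.exp (2 * (k + 1) * Real.log n) = (n : ℝ) ^ (2 * k) * n ^ 2 := by
    rw [show 2 * ((k : ℝ) + 1) * Real.log n = (2 * k + 2 : ℕ) * Real.log n by push_cast; ring,
      Real.exp_nat_mul, Real.exp_log hn', pow_add]
  calc ((n : ℝ) + 1) ^ (2 * k) * Real.exp (1 - 2 * (k + 1) * Real.log n)
      ≤ (2 * n) ^ (2 * k) * (Real.exp 1 / ((n : ℝ) ^ (2 * k) * n ^ 2)) := by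
        rw [Real.exp_sub, hexp]
        gcongr
        linarith
    _ = Real.exp 1 * 4 ^ k * ((n : ℝ) ^ 2)⁻¹ := by
        rw [mul_pow, pow_mul 2 2 k]
        norm_num
        field_simp

theorem inv_le_log_div_mul {lam : ℝ} (hlam : 0 < lam) (hlog : lam ≤ Real.log n) :
    (n : ℝ)⁻¹ ≤ Real.log n / (n * lam) := by
  rw [inv_eq_one_div, mul_comm, ← div_div]
  gcongr
  exact (one_le_div hlam).2 hlog

theorem inv_le_sqrt_log_div_mul {lam : ℝ} (hn : 0 < n) (hlam : 0 < lam)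
    (hlog : lam ≤ Real.log n) : (n : ℝ)⁻¹ ≤ √(Real.log n / (n * lam)) := by
  refine Real.le_sqrt_of_sq_le (le_trans ?_ (inv_le_log_div_mul hlam hlog))
  exact pow_le_of_le_one (by positivity) (inv_le_one_of_one_le₀ (Nat.one_le_cast.2 hn)) two_ne_zero

theorem sqrt_mul_twelve_mul_sq_le (k : ℕ) {q : ℝ} (hq : 0 ≤ q) :
    √(k * (12 * (k + 1) * q ^ 2)) ≤ 4 * (k + 1) * q := by
  rw [Real.sqrt_le_left (by positivity)]
  nlinarith [sq_nonneg q, mul_nonneg (Nat.cast_nonneg (α := ℝ) k) (sq_nonneg q)]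

theorem condProb_le_sum_sq_empirical_sub_le_inv_sq (hT : tangent h ≠ ⊥)
    (hR : R ∈ constraintSet h a) {p : ℝ} (hp : 0 < p) (hpR : ∀ x, p ≤ R x) (hn : 0 < n)
    (hlogp : 2 * (k + 1) * Real.log n ≤ n * (p ^ 2 / 4)) {s₀ : Fin n → Fin k}
    (hs₀ : empirical s₀ ∈ constraintSet h a) (hkl : n * kl (empirical s₀) R ≤ 1) {ρ : ℝ}
    (hρ : 2 * (k + 1) * Real.log n ≤ n * (lambdaMin (projHessian (tangent h) R) / 6 * ρ)) :
    condProb R {s : Fin n → Fin k | ρ ≤ ∑ x, (empirical s x - R x) ^ 2}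
        {s | empirical s ∈ constraintSet h a}
      ≤ Real.exp 1 * 4 ^ k * ((n : ℝ) ^ 2)⁻¹ := by
  have hmin : 2 * (k + 1) * Real.log n
      ≤ n * min (p ^ 2 / 4) (lambdaMin (projHessian (tangent h) R) / 6 * ρ) := by
    rw [mul_min_of_nonneg _ _ (Nat.cast_nonneg n)]
    exact le_min hlogp hρ
  refine (condProb_le_sum_sq_empirical_sub_le hT hR hp hpR hn hs₀ ρ).trans
    (le_trans ?_ (add_one_pow_mul_exp_sub_log_le k hn))
  gcongr

/-- The constant of the total variation bound for an alphabet of size `k`: its three terms come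
from the finite exchangeability error, the concentration radius and the large deviation tail. -/
noncomputable def rateConst (k : ℕ) : ℝ :=
  1 + 2 * (k + 1) + Real.exp 1 * 4 ^ k

theorem rateConst_pos (k : ℕ) : 0 < rateConst k := by
  unfold rateConst
  positivity

theorem IsInfoProj.tvDist_predictive_le_rateConst_mul (hT : tangent h ≠ ⊥) (hQ : ∀ x, 0 < Q x)
    (hR : IsInfoProj Q (constraintSet h a) R) {p lam : ℝ} (hp : 0 < p) (hpR : ∀ x, p ≤ R x)
    (hlam : lam = lambdaMin (projHessian (tangent h) R)) (hlog : lam ≤ Real.log n)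
    (hlogp : 2 * (k + 1) * Real.log n ≤ n * (p ^ 2 / 4)) {s₀ : Fin n → Fin k}
    (hs₀ : empirical s₀ ∈ constraintSet h a) (hkl : n * kl (empirical s₀) R ≤ 1)
    (hm : m ≤ √(n * lam / Real.log n)) :
    tvDist (predictive Q (constraintSet h a) n m) (productLaw R m)
      ≤ rateConst k * (m * √(Real.log n / (n * lam))) := by
  have hlam0 : 0 < lam := hlam ▸ lambdaMin_projHessian_pos _ hT hR.1.1
  have hn : 0 < n := by
    rw [Nat.pos_iff_ne_zero]
    rintro rfl
    simp only [Nat.cast_zero, Real.log_zero] at hlog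
    linarith
  have hn' : (0 : ℝ) < n := Nat.cast_pos.2 hn
  have hlog0 : 0 < Real.log n := hlam0.trans_le hlog
  set q := √(Real.log n / (n * lam)) with hq
  have hq0 : 0 < q := Real.sqrt_pos.2 (by positivity)
  have hqsq : q ^ 2 = Real.log n / (n * lam) := Real.sq_sqrt (by positivity)
  have hnq : (n : ℝ)⁻¹ ≤ q := inv_le_sqrt_log_div_mul hn hlam0 hlog
  have hmq : m ≤ q⁻¹ := by rwa [hq, ← Real.sqrt_inv, inv_div]
  have hmn : m ≤ n := Nat.cast_le.1 (hmq.trans (inv_le_of_inv_le₀ hn' hnq))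
  have hexchangeable : (m : ℝ) ^ 2 / n ≤ m * q := by
    calc (m : ℝ) ^ 2 / n = m * (m * (n : ℝ)⁻¹) := by ring
      _ ≤ m * (q⁻¹ * q ^ 2) := by
        gcongr
        exact hqsq ▸ inv_le_log_div_mul hlam0 hlog
      _ = m * q := by field_simp
  set ρ := 12 * (k + 1) * q ^ 2 with hρ
  have hradius : √(k * ρ) ≤ 4 * (k + 1) * q := sqrt_mul_twelve_mul_sq_le k hq0.le
  have htail := condProb_le_sum_sq_empirical_sub_le_inv_sq (ρ := ρ) hT hR.1 hp hpR hn hlogp hs₀ hkl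
    (le_of_eq (by rw [← hlam, hρ, hqsq]; field_simp; ring))
  have hinv : ((n : ℝ) ^ 2)⁻¹ ≤ q :=
    (inv_anti₀ hn' (le_self_pow₀ (Nat.one_le_cast.2 hn) two_ne_zero)).trans hnq
  calc tvDist (predictive Q (constraintSet h a) n m) (productLaw R m)
      ≤ _ := hR.tvDist_predictive_le hQ hn hmn ⟨s₀, hs₀⟩ ρ
    _ ≤ m * q + m * (1 / 2 * (4 * (k + 1) * q) + Real.exp 1 * 4 ^ k * q) := by
        gcongr
        exact htail.trans (by gcongr)
    _ = rateConst k * (m * q) := by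
        rw [rateConst]
        ring

end Rate

/-! ### Large feasible sample sizes -/

section Asymptotic

variable {h : Fin k → Fin d → ℝ} {a : Fin d → ℝ} {Q R : Fin k → ℝ} {lam : ℝ} {m : ℕ → ℕ}

theorem eventually_mul_log_le_mul (c : ℝ) {r : ℝ} (hr : 0 < r) :
    ∀ᶠ n : ℕ in atTop, c * Real.log n ≤ n * r := by
  have hlog : (fun n : ℕ => c * Real.log n) =o[atTop] fun n : ℕ => (n : ℝ) :=
    (Real.isLittleO_log_id_atTop.comp_tendsto tendsto_natCast_atTop_atTop).const_mul_left c
  filter_upwards [hlog.bound hr] with n hn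
  rw [Real.norm_natCast, mul_comm r] at hn
  exact (le_abs_self _).trans hn

theorem IsInfoProj.eventually_tvDist_predictive_le (hT : tangent h ≠ ⊥)
    (hlat : IsLatticeConstraint h) (hQ : ∀ x, 0 < Q x) (hR : IsInfoProj Q (constraintSet h a) R)
    (hlam : lam = lambdaMin (projHessian (tangent h) R))
    (hm : (fun n => (m n : ℝ)) =o[feasibleAtTop (constraintSet h a)]
      fun n : ℕ => √(n * lam / Real.log n)) :
    ∀ᶠ n in feasibleAtTop (constraintSet h a),
      tvDist (predictive Q (constraintSet h a) n (m n)) (productLaw R (m n))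
        ≤ rateConst k * (m n * √(Real.log n / (n * lam))) := by
  obtain ⟨p, hp, hpR⟩ := exists_pos_forall_le hR.1.1
  have hatTop : feasibleAtTop (constraintSet h a) ≤ atTop := inf_le_left
  have hlog : Tendsto (fun n : ℕ => Real.log n) atTop atTop :=
    Real.tendsto_log_atTop.comp tendsto_natCast_atTop_atTop
  filter_upwards [hlat.eventually_exists_mul_kl_le hR.1 one_pos, hm.bound one_pos,
    hatTop (hlog.eventually_ge_atTop lam),
    hatTop (eventually_mul_log_le_mul (2 * (k + 1)) (r := p ^ 2 / 4) (by positivity))]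
    with n ⟨s₀, hs₀, hkl⟩ hmn hlamn hlogp
  rw [one_mul, Real.norm_natCast, Real.norm_of_nonneg (Real.sqrt_nonneg _)] at hmn
  exact hR.tvDist_predictive_le_rateConst_mul hT hQ hp hpR hlam hlamn hlogp hs₀ hkl hmn

theorem tendsto_mul_sqrt_log_div_mul {l : Filter ℕ}
    (hm : (fun n => (m n : ℝ)) =o[l] fun n : ℕ => √(n * lam / Real.log n)) :
    Tendsto (fun n : ℕ => m n * √(Real.log n / (n * lam))) l (nhds 0) := by
  refine hm.tendsto_div_nhds_zero.congr fun n => ?_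
  rw [div_eq_mul_inv, ← Real.sqrt_inv, inv_div]

end Asymptotic

end ConstrainedPrediction

theorem mainTheorem9_general (k : ℕ) :
    ∃ C : ℝ, 0 < C ∧
      ∀ (d : ℕ) (h : Fin k → Fin d → ℝ) (a : Fin d → ℝ) (Q R : Fin k → ℝ) (lam : ℝ),
        tangent h ≠ ⊥ → IsLatticeConstraint h → (∀ x, 0 < Q x) →
        IsInfoProj Q (constraintSet h a) R →
        lam = lambdaMin (projHessian (tangent h) R) →
        ∀ m : ℕ → ℕ,
          (fun n => (m n : ℝ)) =o[feasibleAtTop (constraintSet h a)]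
            (fun n : ℕ => √(n * lam / Real.log n)) →
          (∀ᶠ n : ℕ in feasibleAtTop (constraintSet h a),
            tvDist (predictive Q (constraintSet h a) n (m n)) (productLaw R (m n))
              ≤ C * (m n * √(Real.log n / (n * lam)))) ∧
          Tendsto (fun n => tvDist (predictive Q (constraintSet h a) n (m n)) (productLaw R (m n)))
            (feasibleAtTop (constraintSet h a)) (nhds 0) := by
  refine ⟨rateConst k, rateConst_pos k, fun d h a Q R lam hT hlat hQ hR hlam m hm => ?_⟩
  have hbound := hR.eventually_tvDist_predictive_le hT hlat hQ hlam hm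
  have hrate := (tendsto_mul_sqrt_log_div_mul hm).const_mul (rateConst k)
  rw [mul_zero] at hrate
  exact ⟨hbound, squeeze_zero' (.of_forall fun n => tvDist_nonneg _ _) hbound hrate⟩

theorem mainTheorem9 (k : ℕ) :
    ∃ C : ℝ, 0 < C ∧
      ∀ (d p : ℕ) (h : Fin k → Fin d → ℝ) (Θ : Set (EuclideanSpace ℝ (Fin p)))
        (α : EuclideanSpace ℝ (Fin p) → Fin d → ℝ) (Q P₀ : Fin k → ℝ)
        (θ₀ : EuclideanSpace ℝ (Fin p)),
        tangent h ≠ ⊥ → IsLatticeConstraint h →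
        (∀ x, 0 < Q x) → IsProb Q → IsProb P₀ →
        (∀ θ ∈ Θ, (constraintSet h (α θ)).Nonempty) →
        θ₀ ∈ Θ →
        IsMinOn (fun θ => kl P₀ (infoProj Q (constraintSet h (α θ)))) Θ θ₀ →
        ∀ (Pstar : Fin k → ℝ) (lam : ℝ),
          Pstar = infoProj Q (constraintSet h (α θ₀)) →
          lam = lambdaMin (projHessian (tangent h) Pstar) →
          ∀ m : ℕ → ℕ,
            (fun n => (m n : ℝ)) =o[feasibleAtTop (constraintSet h (α θ₀))]
              (fun n : ℕ => √((n : ℝ) * lam / Real.log n)) →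
            (∀ᶠ n : ℕ in feasibleAtTop (constraintSet h (α θ₀)),
              tvDist (predictive Q (constraintSet h (α θ₀)) n (m n)) (productLaw Pstar (m n))
                ≤ C * ((m n : ℝ) * √(Real.log n / ((n : ℝ) * lam)))) ∧
            Tendsto
              (fun n => tvDist (predictive Q (constraintSet h (α θ₀)) n (m n))
                (productLaw Pstar (m n)))
              (feasibleAtTop (constraintSet h (α θ₀))) (nhds 0) := by
  obtain ⟨C, hC, hrate⟩ := mainTheorem9_general k
  exact ⟨C, hC, fun d p h Θ α Q P₀ θ₀ hT hlat hQ _ _ hne hθ₀ _ Pstar lam hP hlam =>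
    hrate d h (α θ₀) Q Pstar lam hT hlat hQ (hP ▸ isInfoProj_infoProj hQ (hne θ₀ hθ₀)) hlam⟩
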